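/- Consider a network of $n=h+d$ nodes, $h\ge 1$ honest ones and $d\ge 0$ adversarial ones; let $q=d/n$. Let $k,m_0,\ell\ge 1$ be integers, $\tfrac12<a\le b<1$, and $q<\beta<\tfrac12$. The honest nodes start with arbitrary (possibly random) opinions in $\{0,1\}$. In round $m=1,2,\dots$ every honest node queries independently and uniformly chosen nodes (repetitions and self-queries are allowed), one after another, until it has received exactly $k$ responses; let $\eta_m(j)$ be the number of $1$s among the responses to node $j$. An honest node always responds with its current opinion. After that a common random threshold $X_m$ is revealed, uniform on $[a,b]$ if $m=1$ and on $[\beta,1-\beta]$ if $m\ge 2$ (all queries and thresholds are independent). Each honest node $j$ without final opinion adopts opinion $1$ if $\eta_m(j)/k\ge X_m$, and $0$ otherwise. An opinion that a node has held in $\ell$ consecutive rounds, counted from round $m_0+1$ on, becomes final and never changes again. The adversary is semi-cautious: before each round, knowing the whole past, he fixes one opinion for each of his nodes for this round, and to each query of this round the node either responds with this opinion or remains silent, so that it never gives contradicting responses in a round. Let $H_i$ be the event that all honest nodes eventually reach the final opinion $i$, and $\mathcal N$ the number of rounds until all honest nodes have final opinions. Put $$\varepsilon=e^{-\frac12k(\beta-q)^2},\qquad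 \varphi=\frac{\beta-q}{2(1-q)}-\varepsilon,$$ $$W(n,k,m_0,\ell,u)=(1-q)n\Big(\big(1-(1-\varepsilon)^\ell\big)^u+\Big(\frac{\varepsilon}{1-\varepsilon}\Big)^{\ell-1}\Big)+(m_0+\ell u)\,e^{-2(1-q)n\varphi^2},$$ $$\psi_{semi}(n,k)=2\exp\Big(-\tfrac18 n\tfrac{(\beta-q)^2}{4(1-q)}\Big)+\frac{\frac1{2-q}-\beta+\sqrt{2k^{-1}\ln\frac{4(1-q)}{\beta-q}}}{1-2\beta}.$$ Assume that $\varphi>0$ and $$\frac1{2-q}-\beta+\sqrt{2k^{-1}\ln\tfrac{4(1-q)}{\beta-q}}<1-2\beta .$$ Then, for every strategy of a semi-cautious adversary and every integer $u\ge 0$: if $m_0\ge 3$, then $$\mathbb P\big[(H_0\cup H_1)\cap\{\mathcal N\le m_0+\ell u\}\big]\ \ge\ 1-\psi_{semi}(n,k)^{m_0}-W(n,k,m_0,\ell,u);$$ and for every $m_0\ge 1$ (in particular for $m_0\in\{1,2\}$) the same bound holds with $\psi_{semi}(n,k)^{m_0-1}$ in place of $\psi_{semi}(n,k)^{m_0}$.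 -/

import Mathlib

open MeasureTheory

namespace FPC

/-! ### Protocol parameters, nodes and sources of randomness -/

/-- The parameters of the protocol: `k` responses per node and round, cooling-off period `m₀`,
finalization length `ℓ`, first-round threshold limits `a ≤ b`, later threshold parameter `β`. -/
structure Params where
  k : ℕ
  m₀ : ℕ
  ℓ : ℕ
  a : ℝ
  b : ℝ
  β : ℝ

/-- The `n = h + d` nodes of the network: `h` honest ones and `d` adversarial ones. -/
abbrev Node (h d : ℕ) : Type := Fin h ⊕ Fin d

/-- The queries of one round: `Q j t` is the node to which the honest node `j` addresses
its query number `t` (`t = 0, 1, 2, …`). -/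
abbrev Queries (h d : ℕ) : Type := Fin h → ℕ → Node h d

/-- The protocol's randomness in one round: all the queries, and the common decision threshold. -/
abbrev RoundData (h d : ℕ) : Type := Queries h d × ℝ

/-- A sample point: a seed (everything random that precedes the protocol, such as the initial
opinions and the adversary's private coins) and the randomness of the rounds; the coordinate
`m : ℕ` belongs to round number `m + 1`. -/
abbrev Sample (S : Type*) (h d : ℕ) : Type _ := S × (ℕ → RoundData h d)

/-- The information available when the first `m` rounds are over. -/
abbrev History (S : Type*) (h d m : ℕ) : Type _ := S × (Fin m → RoundData h d)

/-- The history of the first `m` rounds at a sample point. -/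
def history {S : Type*} {h d : ℕ} (ω : Sample S h d) (m : ℕ) : History S h d m :=
  (ω.1, fun i => ω.2 i)

/-- The uniform distribution on `[x, y]` (the point mass at `x` if `x = y`). -/
noncomputable def uniformLaw (x y : ℝ) : Measure ℝ :=
  ((volume : Measure ℝ).restrict (Set.Icc 0 1)).map (fun t => x + (y - x) * t)

/-- The law of the queries of one round: independent uniformly chosen nodes
(repetitions and self-queries are allowed). -/
noncomputable def queryLaw (h d : ℕ) : Measure (Queries h d) :=
  Measure.pi fun _ : Fin h => Measure.infinitePi fun _ : ℕ =>
    ProbabilityTheory.uniformOn (Set.univ : Set (Node h d))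

/-- The law of the threshold in round `m + 1`: uniform on `[a, b]` in the first round and
uniform on `[β, 1 - β]` in every later round. -/
noncomputable def thresholdLaw (π : Params) (m : ℕ) : Measure ℝ :=
  if m = 0 then uniformLaw π.a π.b else uniformLaw π.β (1 - π.β)

/-- The law of the whole system: the seed, the queries and the thresholds are all independent. -/
noncomputable def law (π : Params) (h d : ℕ) {S : Type*} [MeasurableSpace S] (ν : Measure S) :
    Measure (Sample S h d) :=
  ν.prod (Measure.infinitePi fun m : ℕ => (queryLaw h d).prod (thresholdLaw π m))

/-! ### The adversary -/

/-- A strategy of a semi-cautious adversary. Before round `m + 1` starts he fixes, knowing the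
seed and the whole history, one opinion for each of his nodes, so that a node never gives
contradicting responses in a round. To each single query (`t`-th query of the honest node `j`
in this round) his node `i` either answers with this opinion or remains silent; this choice may
depend on the seed, on the history and on the queries of the current round (but not on
the threshold of the current round, which is revealed only afterwards). -/
structure SemiCautiousAdversary (S : Type*) [MeasurableSpace S] (h d : ℕ) where
  /-- the opinions of the adversarial nodes in round `m + 1` -/
  opinion : ∀ m : ℕ, History S h d m → Fin d → Bool
  measurable_opinion : ∀ m, Measurable (opinion m)
  /-- in round `m + 1`, does node `i` answer the `t`-th query of node `j` if it is asked? -/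
  answers : ∀ m : ℕ, History S h d m × Queries h d → Fin d → Fin h → ℕ → Bool
  measurable_answers : ∀ m, Measurable (answers m)

/-! ### The dynamics of the honest nodes -/

/-- The response to the query number `t` of node `j`: `none` stands for silence. -/
def response {h d : ℕ} (honest : Fin h → Bool) (adv : Fin d → Bool)
    (ans : Fin d → Fin h → ℕ → Bool) (Q : Queries h d) (j : Fin h) (t : ℕ) : Option Bool :=
  match Q j t with
  | Sum.inl i => some (honest i)
  | Sum.inr i => if ans i j t then some (adv i) else none

/-- The number of `1`s among the first `k` responses in a sequence of query results. A node
issues queries until it has `k` responses, so the query number `t` counts if and only if it is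
answered and fewer than `k` of the queries before it have been answered. -/
noncomputable def onesAmongFirst (k : ℕ) (r : ℕ → Option Bool) : ℕ :=
  Set.ncard {t : ℕ | r t = some true ∧ ((Finset.range t).filter fun s => (r s).isSome).card < k}

/-- The local state of an honest node after a round. -/
structure NodeState where
  /-- the current opinion -/
  opinion : Bool
  /-- the number of the latest consecutive rounds, after the cooling-off period, at the end
  of which the node had its current opinion -/
  run : ℕ
  /-- whether the opinion is final -/
  final : Bool

/-- The state after round number `r`, if `new` is the outcome of the decision rule: a final opinion
is kept for ever, and an opinion held during `ℓ` consecutive rounds, counted from round `m₀ + 1` on,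
becomes final. -/
def NodeState.update (π : Params) (r : ℕ) (new : Bool) (s : NodeState) : NodeState :=
  if s.final then s
  else
    let run' := if r ≤ π.m₀ then 0 else if new = s.opinion then s.run + 1 else 1
    { opinion := new, run := run', final := decide (π.ℓ ≤ run') }

section Dynamics

variable {S : Type*} [MeasurableSpace S] {h d : ℕ}

/-- The states of the honest nodes after `m` rounds. In round `m + 1` every node `j` collects `k`
responses, `η` of which are `1`, and its decision rule yields `1` if and only if
`η / k ≥ X`, where `X` is the common threshold of the round. -/
noncomputable def state (π : Params) (init : S → Fin h → Bool) (A : SemiCautiousAdversary S h d)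
    (ω : Sample S h d) : ℕ → Fin h → NodeState
  | 0 => fun j => { opinion := init ω.1 j, run := 0, final := false }
  | m + 1 => fun j =>
      let Q := (ω.2 m).1
      let X := (ω.2 m).2
      let η := onesAmongFirst π.k
        (response (fun i => (state π init A ω m i).opinion) (A.opinion m (history ω m))
          (A.answers m (history ω m, Q)) Q j)
      open Classical in
      (state π init A ω m j).update π (m + 1) (decide (X ≤ (η : ℝ) / (π.k : ℝ)))

/-- The event `H_i`: all honest nodes eventually reach the final opinion `i`. -/
def consensusOn (π : Params) (init : S → Fin h → Bool) (A : SemiCautiousAdversary S h d)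
    (i : Bool) : Set (Sample S h d) :=
  {ω | ∀ j, ∃ m, (state π init A ω m j).final = true ∧ (state π init A ω m j).opinion = i}

/-- The number of rounds until all honest nodes have final opinions (`⊤` if this never happens). -/
noncomputable def roundsToFinality (π : Params) (init : S → Fin h → Bool)
    (A : SemiCautiousAdversary S h d) (ω : Sample S h d) : ℕ∞ :=
  ⨆ j : Fin h, ⨅ (m : ℕ) (_ : (state π init A ω m j).final = true), (m : ℕ∞)

/-- The event `(H₀ ∪ H₁) ∩ {𝒩 ≤ M}`. -/
def consensusWithin (π : Params) (init : S → Fin h → Bool) (A : SemiCautiousAdversary S h d)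
    (M : ℕ) : Set (Sample S h d) :=
  (consensusOn π init A false ∪ consensusOn π init A true) ∩
    {ω | roundsToFinality π init A ω ≤ (M : ℕ∞)}

end Dynamics

/-! ### The quantities in the estimate -/

/-- `e^{-k (β - q)² / 2}` -/
noncomputable def errProb (β q : ℝ) (k : ℕ) : ℝ := Real.exp (-(1 / 2) * k * (β - q) ^ 2)

/-- `φ_{β,q,k} = (β - q) / (2 (1 - q)) - e^{-k (β - q)² / 2}` -/
noncomputable def phi (β q : ℝ) (k : ℕ) : ℝ := (β - q) / (2 * (1 - q)) - errProb β q k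

/-- `W(n, k, m₀, ℓ, u)` -/
noncomputable def W (β q : ℝ) (n k m₀ ℓ u : ℕ) : ℝ :=
  (1 - q) * n * ((1 - (1 - errProb β q k) ^ ℓ) ^ u
      + (errProb β q k / (1 - errProb β q k)) ^ (ℓ - 1))
    + ((m₀ : ℝ) + ℓ * u) * Real.exp (-2 * (1 - q) * n * phi β q k ^ 2)

/-- `1/(2 - q) - β + √(2 k⁻¹ ln (4 (1 - q) / (β - q)))` -/
noncomputable def controlLength (β q : ℝ) (k : ℕ) : ℝ :=
  1 / (2 - q) - β + Real.sqrt (2 * (k : ℝ)⁻¹ * Real.log (4 * (1 - q) / (β - q)))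

/-- `ψ_semi(n, k)` -/
noncomputable def psiSemi (β q : ℝ) (n k : ℕ) : ℝ :=
  2 * Real.exp (-(1 / 8) * n * ((β - q) ^ 2 / (4 * (1 - q))))
    + controlLength β q k / (1 - 2 * β)

end FPC

/-! ### Counting the `1`s among the first `k` responses -/

namespace FPC

/-! Call the honest nodes near consensus on `i` if at most the fraction θ = (β-q)/(2(1-q)) of them
holds the other opinion. Near consensus, with a threshold in [β, 1-β], a node disagrees with `i`
only if its proportion of `1`s is off its mean by at least (β-q)/2. By Hoeffding this has
probability at most ε (`dissent_prob_le`), and a second Hoeffding bound, over the nodes, shows that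
near consensus survives a round except with probability e = exp(-2(1-q)nφ²)
(`nearConsensus_lost_prob_le`). The answers may depend on all queries of the round, so the decisions
are not independent. `ones_le_extremal` and `extremal_le_ones` enclose them in events that concern
the queries of one node only, and these are independent.

Away from near consensus, choosing between answer and silence moves the mean proportion of `1`s only
between `lowerRate` and `upperRate`. A threshold that clears this interval by a margin sends almost
all nodes to the same side. The interval meets [β, 1-β] in length at most q(1-β)
(`controlled_interval_le`), so a round fails with probability at most f = `failProb`. The argument
uses only rounds 2 to m₀ of the cooling-off period, whence f^(m₀-1). Then f ≤ ψ gives the general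
bound, and f² ≤ ψ³ gives f^(m₀-1) ≤ ψ^m₀ for m₀ ≥ 3 (`failProb_pow_le`).

After the cooling-off period a node is compared with independent trials of failure probability ε: it
should see ℓ successes in a row within ℓu rounds, and not ℓ failures in a row before that. The sum
of the two corresponding bounds is `nodePotential`. Summed over the nodes, with e added for each
remaining round and truncated at 1, it is a supermartingale (`consensusPotential_step`);
`coolingPotential_step` is the analogue for the cooling-off period. Both drift inequalities hold for
every past, which disposes of the adaptivity of the adversary. `lintegral_law_resample` turns them
into inequalities between expectations, and `one_sub_le_consensusWithin` concatenates these. -/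

/-- The number of responses equal to `b` among the first `t` query results. -/
def responseCount (b : Bool) (r : ℕ → Option Bool) (t : ℕ) : ℕ :=
  ((Finset.range t).filter fun s => r s = some b).card

theorem responseCount_zero (b : Bool) (r : ℕ → Option Bool) : responseCount b r 0 = 0 := by
  simp [responseCount]

theorem responseCount_succ (b : Bool) (r : ℕ → Option Bool) (t : ℕ) :
    responseCount b r (t + 1) = responseCount b r t + if r t = some b then 1 else 0 := by
  unfold responseCount
  rw [Finset.card_filter, Finset.sum_range_succ, ← Finset.card_filter]

theorem card_isSome_eq (r : ℕ → Option Bool) (t : ℕ) :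
    ((Finset.range t).filter fun s => (r s).isSome).card
      = responseCount true r t + responseCount false r t := by
  induction t with
  | zero => simp [responseCount]
  | succ t ih =>
    rw [responseCount_succ, responseCount_succ, Finset.card_filter, Finset.sum_range_succ,
      ← Finset.card_filter, ih]
    rcases h : r t with _ | b
    · simp
    · cases b <;> simp <;> omega

theorem responseCount_monotone (b : Bool) (r : ℕ → Option Bool) : Monotone (responseCount b r) := by
  refine monotone_nat_of_le_succ fun t => ?_
  rw [responseCount_succ]; omega

/-- The indices of the `1`s among the first `k` responses. -/
def onesSet (k : ℕ) (r : ℕ → Option Bool) : Set ℕ :=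
  {t : ℕ | r t = some true ∧ responseCount true r t + responseCount false r t < k}

theorem onesAmongFirst_eq (k : ℕ) (r : ℕ → Option Bool) :
    onesAmongFirst k r = (onesSet k r).ncard := by
  simp only [onesAmongFirst, onesSet, card_isSome_eq]

/-- The number of earlier `1`s is injective on this set and stays below `k`. Finiteness is what
makes `ncard` meaningful when silence lasts for ever. -/
theorem onesSet_finite (k : ℕ) (r : ℕ → Option Bool) : (onesSet k r).Finite := by
  refine Set.Finite.of_injOn (f := responseCount true r) (t := Set.Iio k) ?_ ?_ (Set.finite_Iio k)
  · intro t ht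
    have := ht.2
    simp only [Set.mem_Iio]; omega
  · have key : ∀ s t, r s = some true → s < t → responseCount true r s < responseCount true r t := by
      intro s t hs hst
      have h1 := responseCount_monotone true r (Nat.succ_le_of_lt hst)
      have h2 := responseCount_succ true r s
      simp only [hs, if_true] at h2
      simp only [Nat.succ_eq_add_one] at h1
      omega
    intro s hs t ht hst
    rcases lt_trichotomy s t with h | h | h
    · have := key s t hs.1 h; omega
    · exact h
    · have := key t s ht.1 h; omega

theorem responseCount_le_of_lt (k : ℕ) (r : ℕ → Option Bool) (t : ℕ)
    (h : ∀ s < t, responseCount true r s + responseCount false r s < k) :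
    responseCount true r t ≤ onesAmongFirst k r := by
  rw [onesAmongFirst_eq, responseCount, ← Set.ncard_coe_finset]
  refine Set.ncard_le_ncard ?_ (onesSet_finite k r)
  intro s hs
  simp only [Finset.coe_filter, Finset.mem_range, Set.mem_ofPred_eq] at hs
  exact ⟨hs.2, h s hs.1⟩

/-- If `k` responses have already arrived one step earlier, then at most `k - m` of them are `0`s,
so at least `m` are `1`s and one can step back in time until all queries in question count. -/
theorem le_onesAmongFirst_of (k m : ℕ) (r : ℕ → Option Bool) (t : ℕ)
    (h1 : m ≤ responseCount true r t) (h2 : m + responseCount false r t ≤ k) :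
    m ≤ onesAmongFirst k r := by
  induction t with
  | zero => rw [responseCount_zero] at h1; omega
  | succ t ih =>
    have hm := responseCount_monotone false r (Nat.le_succ t)
    simp only [Nat.succ_eq_add_one] at hm
    by_cases hc : responseCount true r t + responseCount false r t < k
    · refine h1.trans (responseCount_le_of_lt k r _ fun s hs => ?_)
      have a := responseCount_monotone true r (Nat.lt_succ_iff.1 hs)
      have b := responseCount_monotone false r (Nat.lt_succ_iff.1 hs)
      omega
    · exact ih (by omega) (by omega)

/-- The witness is the instant just after the last counted `1`: fewer than `k` responses precede
that query. -/
theorem exists_responseCount (k : ℕ) (r : ℕ → Option Bool) :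
    ∃ t, onesAmongFirst k r ≤ responseCount true r t ∧
      onesAmongFirst k r + responseCount false r t ≤ k := by
  rcases (onesSet k r).eq_empty_or_nonempty with h | h
  · refine ⟨0, ?_, ?_⟩ <;> simp [onesAmongFirst_eq, h, responseCount_zero]
  · obtain ⟨t, ht, hmax⟩ := (onesSet_finite k r).exists_maximalFor id _ h
    have hle : onesAmongFirst k r ≤ responseCount true r (t + 1) := by
      rw [onesAmongFirst_eq, responseCount, ← Set.ncard_coe_finset]
      refine Set.ncard_le_ncard ?_ (Finset.finite_toSet _)
      intro s hs
      simp only [Finset.coe_filter, Finset.mem_range, Set.mem_ofPred_eq]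
      refine ⟨?_, hs.1⟩
      by_contra hlt
      have := hmax hs (by simp only [id]; omega)
      simp only [id] at this
      omega
    have e1 := responseCount_succ true r t
    have e2 := responseCount_succ false r t
    have := ht.2
    simp only [ht.1, Option.some.injEq, Bool.true_eq_false, if_true, if_false] at e1 e2
    exact ⟨t + 1, hle, by omega⟩

/-- A race: `m` ones must arrive before the number of zeros exceeds `k - m`. Monotonicity, the
first-step recursion and measurability are all read off from this form. -/
theorem le_onesAmongFirst_iff (k m : ℕ) (r : ℕ → Option Bool) :
    m ≤ onesAmongFirst k r ↔
      ∃ t, m ≤ responseCount true r t ∧ m + responseCount false r t ≤ k := by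
  constructor
  · intro h
    obtain ⟨t, h1, h2⟩ := exists_responseCount k r
    exact ⟨t, by omega, by omega⟩
  · rintro ⟨t, h1, h2⟩
    exact le_onesAmongFirst_of k m r t h1 h2

/-- Turning a `0` into silence, or silence into a `1`, can only help the ones in the race. This
identifies the extremal behaviour of the adversary. -/
theorem onesAmongFirst_mono (k : ℕ) (r r' : ℕ → Option Bool)
    (h1 : ∀ t, r t = some true → r' t = some true)
    (h0 : ∀ t, r' t = some false → r t = some false) :
    onesAmongFirst k r ≤ onesAmongFirst k r' := by
  rw [le_onesAmongFirst_iff]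
  obtain ⟨t, ht1, ht0⟩ := exists_responseCount k r
  refine ⟨t, ht1.trans (Finset.card_le_card ?_), le_trans (Nat.add_le_add_left
    (Finset.card_le_card ?_) _) ht0⟩
  · exact Finset.monotone_filter_right _ fun s _ => h1 s
  · exact Finset.monotone_filter_right _ fun s _ => h0 s

theorem onesAmongFirst_le (k : ℕ) (r : ℕ → Option Bool) : onesAmongFirst k r ≤ k := by
  obtain ⟨t, h1, h2⟩ := exists_responseCount k r
  omega

/-- Put a query result in front of a sequence of query results. -/
def consSeq {α : Type*} (a : α) (r : ℕ → α) : ℕ → α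
  | 0 => a
  | t + 1 => r t

theorem responseCount_consSeq (b : Bool) (a : Option Bool) (r : ℕ → Option Bool) (t : ℕ) :
    responseCount b (consSeq a r) (t + 1) = responseCount b r t + if a = some b then 1 else 0 := by
  unfold responseCount
  rw [Finset.card_filter, Finset.sum_range_succ', Finset.card_filter]
  rfl

/-- This and the next two lemmas are the first-step recursion: silence leaves the number of missing
responses unchanged, an answer lowers it by one. -/
theorem onesAmongFirst_cons_none (k : ℕ) (r : ℕ → Option Bool) :
    onesAmongFirst k (consSeq none r) = onesAmongFirst k r := by
  refine eq_of_forall_le_iff fun m => ?_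
  rw [le_onesAmongFirst_iff, le_onesAmongFirst_iff]
  constructor
  · rintro ⟨t, h1, h2⟩
    cases t with
    | zero => exact ⟨0, by simpa [responseCount_zero] using h1, by
        simpa [responseCount_zero] using h2⟩
    | succ t =>
      simp only [responseCount_consSeq] at h1 h2
      exact ⟨t, by simpa using h1, by simpa using h2⟩
  · rintro ⟨t, h1, h2⟩
    exact ⟨t + 1, by simpa [responseCount_consSeq] using h1, by
      simpa [responseCount_consSeq] using h2⟩

theorem onesAmongFirst_cons_false (k : ℕ) (r : ℕ → Option Bool) :
    onesAmongFirst (k + 1) (consSeq (some false) r) = onesAmongFirst k r := by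
  refine eq_of_forall_le_iff fun m => ?_
  rw [le_onesAmongFirst_iff, le_onesAmongFirst_iff]
  constructor
  · rintro ⟨t, h1, h2⟩
    cases t with
    | zero =>
      simp only [responseCount_zero] at h1
      exact ⟨0, by omega, by simp only [responseCount_zero]; omega⟩
    | succ t =>
      simp only [responseCount_consSeq] at h1 h2
      exact ⟨t, by simpa using h1, by simp at h2; omega⟩
  · rintro ⟨t, h1, h2⟩
    exact ⟨t + 1, by simpa [responseCount_consSeq] using h1, by
      simp [responseCount_consSeq]; omega⟩

theorem onesAmongFirst_cons_true (k : ℕ) (r : ℕ → Option Bool) :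
    onesAmongFirst (k + 1) (consSeq (some true) r) = onesAmongFirst k r + 1 := by
  refine eq_of_forall_le_iff fun m => ?_
  rcases m with _ | m
  · simp
  rw [Nat.add_le_add_iff_right, le_onesAmongFirst_iff, le_onesAmongFirst_iff]
  constructor
  · rintro ⟨t, h1, h2⟩
    cases t with
    | zero => simp [responseCount_zero] at h1
    | succ t =>
      simp only [responseCount_consSeq] at h1 h2
      exact ⟨t, by simpa using h1, by simp at h2; omega⟩
  · rintro ⟨t, h1, h2⟩
    exact ⟨t + 1, by simpa [responseCount_consSeq] using h1, by
      simp [responseCount_consSeq]; omega⟩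

theorem onesAmongFirst_zero (r : ℕ → Option Bool) : onesAmongFirst 0 r = 0 :=
  Nat.le_zero.1 (onesAmongFirst_le 0 r)

instance instMeasurableSpaceOptionBool : MeasurableSpace (Option Bool) := ⊤

instance instDiscreteMeasurableSpaceOptionBool : DiscreteMeasurableSpace (Option Bool) :=
  ⟨fun _ => trivial⟩

instance instDiscreteMeasurableSpaceSum {α β : Type*} [MeasurableSpace α] [MeasurableSpace β]
    [DiscreteMeasurableSpace α] [DiscreteMeasurableSpace β] : DiscreteMeasurableSpace (α ⊕ β) :=
  ⟨fun _ => measurableSet_sum_iff.2 ⟨.of_discrete, .of_discrete⟩⟩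

theorem measurable_responseCount (b : Bool) (t : ℕ) :
    Measurable fun r : ℕ → Option Bool => responseCount b r t := by
  induction t with
  | zero => simp only [responseCount_zero]; exact measurable_const
  | succ t ih =>
    simp only [responseCount_succ]
    exact ih.add ((Measurable.of_discrete (f := fun o : Option Bool =>
      if o = some b then 1 else 0)).comp (measurable_pi_apply t))

theorem measurable_onesAmongFirst (k : ℕ) : Measurable (onesAmongFirst k) := by
  refine measurable_of_Ici fun m => ?_
  have : onesAmongFirst k ⁻¹' Set.Ici m =
      ⋃ t, {r | m ≤ responseCount true r t ∧ m + responseCount false r t ≤ k} := by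
    ext r
    simp [le_onesAmongFirst_iff]
  rw [this]
  refine MeasurableSet.iUnion fun t => ?_
  exact (measurableSet_le measurable_const (measurable_responseCount true t)).inter
    (measurableSet_le (measurable_const.add (measurable_responseCount false t)) measurable_const)

end FPC

/-! ### Hoeffding bounds for the responses to a single node -/

namespace FPC

open ProbabilityTheory

theorem measurable_consSeq {α : Type*} [MeasurableSpace α] :
    Measurable fun p : α × (ℕ → α) => consSeq p.1 p.2 := by
  refine measurable_pi_iff.2 fun t => ?_
  cases t with
  | zero => exact measurable_fst
  | succ t => exact (measurable_pi_apply t).comp measurable_snd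

/-- An i.i.d. sequence with an independent further sample in front is again i.i.d.; this separates
the first query in `mgf_ones`. -/
theorem map_consSeq_infinitePi {α : Type*} [MeasurableSpace α] (κ : Measure α)
    [IsProbabilityMeasure κ] :
    (κ.prod (Measure.infinitePi fun _ : ℕ => κ)).map (fun p => consSeq p.1 p.2)
      = Measure.infinitePi fun _ : ℕ => κ := by
  refine Measure.eq_infinitePi _ fun s t ht => ?_
  obtain ⟨N, hN⟩ := s.exists_nat_subset_range
  classical
  -- Padding with `univ` makes the cylinder rest on an initial segment, which behaves well under the
  -- shift.
  set t' : ℕ → Set α := fun i => if i ∈ s then t i else Set.univ with ht'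
  have hmt' : ∀ i, MeasurableSet (t' i) := fun i => by
    simp only [ht']; split_ifs; exacts [ht i, .univ]
  have hpi : Set.pi (↑s) t = Set.pi (↑(Finset.range (N + 1))) t' := by
    ext f
    simp only [Set.mem_pi, Finset.mem_coe, Finset.mem_range, ht']
    constructor
    · intro h i _
      split_ifs with hi
      exacts [h i hi, trivial]
    · intro h i hi
      have := h i (Nat.lt_succ_of_lt (Finset.mem_range.1 (hN hi)))
      rwa [if_pos hi] at this
  have hprod : ∏ i ∈ s, κ (t i) = ∏ i ∈ Finset.range (N + 1), κ (t' i) := by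
    rw [← Finset.prod_subset (hN.trans (Finset.range_mono (Nat.le_succ N)))
      (fun i _ hi => by simp [ht', hi])]
    exact Finset.prod_congr rfl fun i hi => by simp [ht', hi]
  rw [hpi, hprod, Measure.map_apply measurable_consSeq
    (.pi (Finset.countable_toSet _) fun i _ => hmt' i)]
  have : (fun p : α × (ℕ → α) => consSeq p.1 p.2) ⁻¹' Set.pi (↑(Finset.range (N + 1))) t'
      = t' 0 ×ˢ Set.pi (↑(Finset.range N)) fun i => t' (i + 1) := by
    ext ⟨a, f⟩
    simp only [Set.mem_preimage, Set.mem_pi, Finset.mem_coe, Finset.mem_range, Set.mem_prod]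
    constructor
    · intro h
      exact ⟨h 0 (by omega), fun i hi => h (i + 1) (by omega)⟩
    · rintro ⟨h0, h⟩ i hi
      cases i with
      | zero => exact h0
      | succ i => exact h i (by omega)
  rw [this, Measure.prod_prod, Measure.infinitePi_pi _ (fun i _ => hmt' (i + 1)),
    Finset.prod_range_succ', mul_comm]

/-- Hoeffding's bound for the moment generating function of a Bernoulli variable. -/
theorem bernoulli_mgf_le (p t : ℝ) (h0 : 0 ≤ p) (h1 : p ≤ 1) :
    p * Real.exp t + (1 - p) ≤ Real.exp (t * p + t ^ 2 / 8) := by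
  set μ : Measure Bool := ENNReal.ofReal p • Measure.dirac true +
    ENNReal.ofReal (1 - p) • Measure.dirac false with hμ
  have hprob : IsProbabilityMeasure μ := ⟨by
    simp [hμ, ← ENNReal.ofReal_add h0 (sub_nonneg.2 h1)]⟩
  have hint : ∀ f : Bool → ℝ, ∫ b, f b ∂μ = p * f true + (1 - p) * f false := by
    intro f
    rw [integral_fintype (.of_finite)]
    simp [hμ, Measure.real, h0, h1]
  set X : Bool → ℝ := fun b => if b then 1 else 0 with hX
  have hsub := hasSubgaussianMGF_of_mem_Icc (μ := μ) (X := X) (a := 0) (b := 1)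
    (Measurable.of_discrete.aemeasurable)
    (Filter.Eventually.of_forall fun b => by cases b <;> simp [hX])
  -- Hoeffding's lemma bounds the centred variable by exp(t²/8); the factor exp(tp) removes the
  -- centring.
  have h := hsub.mgf_le t
  rw [mgf, hint, hint X] at h
  simp only [hX, if_true, Bool.false_eq_true, if_false] at h
  have e : ((‖(1 : ℝ) - 0‖₊ / 2) ^ 2 : NNReal) * t ^ 2 / 2 = t ^ 2 / 8 := by
    push_cast; norm_num; ring
  rw [e] at h
  have h2 := mul_le_mul_of_nonneg_left h (Real.exp_pos (t * p)).le
  rw [← Real.exp_add] at h2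
  refine le_trans (le_of_eq ?_) h2
  have a1 : Real.exp t = Real.exp (t * p) * Real.exp (t * (1 - p)) := by
    rw [← Real.exp_add]; ring_nf
  have a2 : Real.exp (t * p) * Real.exp (-(t * p)) = 1 := by
    rw [← Real.exp_add]; simp
  calc _ = p * (Real.exp (t * p) * Real.exp (t * (1 - p))) + (1 - p) * 1 := by rw [← a1]; ring
    _ = p * (Real.exp (t * p) * Real.exp (t * (1 - p)))
        + (1 - p) * (Real.exp (t * p) * Real.exp (-(t * p))) := by rw [a2]
    _ = _ := by ring_nf

variable (κ : Measure (Option Bool)) [IsProbabilityMeasure κ]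

theorem measurable_exp_ones (t : ℝ) (k : ℕ) : Measurable fun r : ℕ → Option Bool =>
    Real.exp (t * (onesAmongFirst k r : ℝ)) :=
  (Measurable.of_discrete (f := fun m : ℕ => Real.exp (t * (m : ℝ)))).comp
    (measurable_onesAmongFirst k)

theorem integrable_exp_ones {Ω : Type*} [MeasurableSpace Ω] (μ : Measure Ω) [IsFiniteMeasure μ]
    (t : ℝ) (k : ℕ) {f : Ω → ℕ → Option Bool} (hf : Measurable f) :
    Integrable (fun ω => Real.exp (t * (onesAmongFirst k (f ω) : ℝ))) μ := by
  refine Integrable.of_bound ((measurable_exp_ones t k).comp hf).aestronglyMeasurable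
    (Real.exp (|t| * k)) (Filter.Eventually.of_forall fun ω => ?_)
  rw [Real.norm_eq_abs, Real.abs_exp, Real.exp_le_exp]
  have h1 : (onesAmongFirst k (f ω) : ℝ) ≤ k := by exact_mod_cast onesAmongFirst_le _ _
  have h2 : (0 : ℝ) ≤ (onesAmongFirst k (f ω) : ℝ) := Nat.cast_nonneg _
  exact mul_le_mul (le_abs_self t) h1 h2 (abs_nonneg t)

/-- First-step analysis of the moment generating function of the number of ones. -/
theorem mgf_ones (t : ℝ) (h : 0 < κ.real {some true} + κ.real {some false}) (k : ℕ) :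
    ∫ r, Real.exp (t * (onesAmongFirst k r : ℝ)) ∂(Measure.infinitePi fun _ : ℕ => κ)
      = (κ.real {some true} / (κ.real {some true} + κ.real {some false}) * Real.exp t
        + (1 - κ.real {some true} / (κ.real {some true} + κ.real {some false}))) ^ k := by
  have hsum : κ.real {none} + κ.real {some true} + κ.real {some false} = 1 := by
    have := integral_fintype (μ := κ) (f := fun _ => (1 : ℝ)) .of_finite
    simp only [integral_const, smul_eq_mul, mul_one, probReal_univ, Fintype.sum_option,
      Fintype.sum_bool] at this
    linarith
  induction k with
  | zero => simp [onesAmongFirst_zero]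
  | succ k ih =>
    set p1 := κ.real {some true}
    set p0 := κ.real {some false}
    set F := ∫ r, Real.exp (t * (onesAmongFirst (k + 1) r : ℝ))
      ∂(Measure.infinitePi fun _ : ℕ => κ) with hF
    -- Condition on the first query. Silence reproduces `F` itself, so the equation is solved for
    -- `F`, which is possible because an answer has positive probability.
    have step : F = κ.real {none} * F
        + p1 * (Real.exp t * ∫ r, Real.exp (t * (onesAmongFirst k r : ℝ))
          ∂(Measure.infinitePi fun _ : ℕ => κ))
        + p0 * ∫ r, Real.exp (t * (onesAmongFirst k r : ℝ))
          ∂(Measure.infinitePi fun _ : ℕ => κ) := by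
      conv_lhs => rw [hF, ← map_consSeq_infinitePi κ]
      rw [integral_map measurable_consSeq.aemeasurable
        (measurable_exp_ones t _).aestronglyMeasurable,
        integral_prod _ (integrable_exp_ones _ t (k + 1) measurable_consSeq),
        integral_fintype .of_finite]
      simp only [Fintype.sum_option, Fintype.sum_bool, onesAmongFirst_cons_none,
        onesAmongFirst_cons_false, onesAmongFirst_cons_true, smul_eq_mul, Nat.cast_add,
        Nat.cast_one, mul_add, mul_one, Real.exp_add, integral_mul_const]
      rw [← hF]
      ring
    rw [ih] at step
    have hne : p1 + p0 ≠ 0 := h.ne'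
    have hn : κ.real {none} = 1 - (p1 + p0) := by linarith
    rw [hn] at step
    have : (p1 + p0) * F = (p1 + p0) * (p1 / (p1 + p0) * Real.exp t + (1 - p1 / (p1 + p0))) ^ (k + 1) := by
      rw [pow_succ]
      have e : (p1 + p0) * (p1 / (p1 + p0) * Real.exp t + (1 - p1 / (p1 + p0)))
          = p1 * Real.exp t + p0 := by field_simp; ring
      linear_combination step - (p1 / (p1 + p0) * Real.exp t + (1 - p1 / (p1 + p0))) ^ k * e
    exact mul_left_cancel₀ hne this

theorem mgf_ones_le (t : ℝ) (h : 0 < κ.real {some true} + κ.real {some false}) (k : ℕ) :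
    ∫ r, Real.exp (t * (onesAmongFirst k r : ℝ)) ∂(Measure.infinitePi fun _ : ℕ => κ)
      ≤ Real.exp (k * (t * (κ.real {some true} / (κ.real {some true} + κ.real {some false}))
        + t ^ 2 / 8)) := by
  rw [mgf_ones κ t h, Real.exp_nat_mul]
  have h0 : 0 ≤ κ.real {some true} / (κ.real {some true} + κ.real {some false}) := by positivity
  have h1 : κ.real {some true} / (κ.real {some true} + κ.real {some false}) ≤ 1 :=
    div_le_one_of_le₀ (le_add_of_nonneg_right measureReal_nonneg) h.le
  exact pow_le_pow_left₀ (add_nonneg (mul_nonneg h0 (Real.exp_pos t).le) (sub_nonneg.2 h1))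
    (bernoulli_mgf_le _ t h0 h1) k

/-- Hoeffding's inequality for the number of ones among the first `k` responses, upper tail. -/
theorem ones_upper_tail (h : 0 < κ.real {some true} + κ.real {some false}) (k : ℕ) (U c δ : ℝ)
    (hU : κ.real {some true} / (κ.real {some true} + κ.real {some false}) ≤ U) (hδ : 0 ≤ δ)
    (hc : U + δ ≤ c) :
    (Measure.infinitePi fun _ : ℕ => κ).real {r | (k : ℝ) * c ≤ (onesAmongFirst k r : ℝ)}
      ≤ Real.exp (-2 * k * δ ^ 2) := by
  -- With deviation δ, the exponent k(t²/8 - tδ) is minimal at t = 4δ, with value -2kδ².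
  have hm := measure_ge_le_exp_mul_mgf (μ := Measure.infinitePi fun _ : ℕ => κ)
    (X := fun r => (onesAmongFirst k r : ℝ)) (t := 4 * δ) (k * c) (by positivity)
    (integrable_exp_ones _ _ k measurable_id)
  refine hm.trans ?_
  have hb := mgf_ones_le κ (4 * δ) h k
  refine (mul_le_mul_of_nonneg_left hb (Real.exp_pos _).le).trans ?_
  rw [← Real.exp_add, Real.exp_le_exp]
  set p := κ.real {some true} / (κ.real {some true} + κ.real {some false})
  have hk : (0 : ℝ) ≤ k := Nat.cast_nonneg k
  have : 0 ≤ (k : ℝ) * δ * (c - p - δ) :=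
    mul_nonneg (mul_nonneg hk hδ) (by linarith)
  nlinarith

/-- Hoeffding's inequality for the number of ones among the first `k` responses, lower tail. -/
theorem ones_lower_tail (h : 0 < κ.real {some true} + κ.real {some false}) (k : ℕ) (U c δ : ℝ)
    (hU : U ≤ κ.real {some true} / (κ.real {some true} + κ.real {some false})) (hδ : 0 ≤ δ)
    (hc : c ≤ U - δ) :
    (Measure.infinitePi fun _ : ℕ => κ).real {r | (onesAmongFirst k r : ℝ) ≤ (k : ℝ) * c}
      ≤ Real.exp (-2 * k * δ ^ 2) := by
  have hm := measure_le_le_exp_mul_mgf (μ := Measure.infinitePi fun _ : ℕ => κ)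
    (X := fun r => (onesAmongFirst k r : ℝ)) (t := -(4 * δ)) (k * c)
    (by linarith) (integrable_exp_ones _ _ k measurable_id)
  refine hm.trans ?_
  have hb := mgf_ones_le κ (-(4 * δ)) h k
  refine (mul_le_mul_of_nonneg_left hb (Real.exp_pos _).le).trans ?_
  rw [← Real.exp_add, Real.exp_le_exp]
  set p := κ.real {some true} / (κ.real {some true} + κ.real {some false})
  have hk : (0 : ℝ) ≤ k := Nat.cast_nonneg k
  have : 0 ≤ (k : ℝ) * δ * (p - c - δ) :=
    mul_nonneg (mul_nonneg hk hδ) (by linarith)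
  nlinarith

end FPC

/-! ### Concentration over the nodes and the extremal adversary -/

namespace FPC

open ProbabilityTheory

/-- Hoeffding's inequality for the number of coordinates that fall into a set. -/
theorem pi_count_tail {α : Type*} [MeasurableSpace α] (μ : Measure α) [IsProbabilityMeasure μ]
    (h : ℕ) (hh : 0 < h) (E : Set α) (hE : MeasurableSet E) [DecidablePred (· ∈ E)]
    (p θ : ℝ) (hp : μ.real E ≤ p) (hpθ : p ≤ θ) :
    (Measure.pi fun _ : Fin h => μ).real
        {Q | θ * h < ((Finset.univ.filter fun j => Q j ∈ E).card : ℝ)}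
      ≤ Real.exp (-2 * h * (θ - p) ^ 2) := by
  set P := Measure.pi fun _ : Fin h => μ
  set f : α → ℝ := E.indicator 1 with hf
  have hfm : Measurable f := measurable_one.indicator hE
  have hint : ∀ j : Fin h, ∫ Q, f (Q j) ∂P = μ.real E := by
    intro j
    have hmp := measurePreserving_eval (fun _ : Fin h => μ) j
    have := integral_map (μ := P) hmp.measurable.aemeasurable
      (f := f) hfm.aestronglyMeasurable
    rw [hmp.map_eq, hf, integral_indicator_one hE] at this
    exact this.symm
  have hind : iIndepFun (fun (j : Fin h) (Q : Fin h → α) => f (Q j) - μ.real E) P :=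
    iIndepFun_pi (μ := fun _ : Fin h => μ) (X := fun _ a => f a - μ.real E)
      fun _ => (hfm.sub_const _).aemeasurable
  have hsub : ∀ j ∈ (Finset.univ : Finset (Fin h)),
      HasSubgaussianMGF (fun Q : Fin h → α => f (Q j) - μ.real E) ((1 / 2) ^ 2) P := by
    intro j _
    have := hasSubgaussianMGF_of_mem_Icc (μ := P) (X := fun Q : Fin h → α => f (Q j))
      (a := 0) (b := 1) (hfm.comp (measurable_pi_apply j)).aemeasurable
      (Filter.Eventually.of_forall fun Q => by
        by_cases hq : Q j ∈ E <;> simp [hf, hq])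
    rw [hint j] at this
    simpa using this
  have hkey := HasSubgaussianMGF.measure_sum_ge_le_of_iIndepFun hind hsub
    (ε := h * (θ - μ.real E)) (mul_nonneg (Nat.cast_nonneg _) (by linarith))
  refine le_trans (measureReal_mono ?_) (hkey.trans ?_)
  · intro Q hQ
    simp only [Set.mem_ofPred_eq] at hQ ⊢
    have : ∑ j : Fin h, (f (Q j) - μ.real E)
        = ((Finset.univ.filter fun j => Q j ∈ E).card : ℝ) - h * μ.real E := by
      rw [Finset.sum_sub_distrib, Finset.card_filter]
      simp [hf, Set.indicator_apply]
    rw [this]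
    linarith
  · rw [Real.exp_le_exp]
    have hpos : (0 : ℝ) < h := by exact_mod_cast hh
    have e : -(h * (θ - μ.real E)) ^ 2 / (2 * ((∑ _j : Fin h, ((1 / 2) ^ 2 : NNReal) : NNReal) : ℝ))
        = -2 * h * (θ - μ.real E) ^ 2 := by
      push_cast
      simp only [Finset.sum_const, Finset.card_univ, Fintype.card_fin, nsmul_eq_mul]
      field_simp
    rw [e]
    -- The true probability may be smaller than `p`; the gap to θ then only widens.
    have : (θ - p) ^ 2 ≤ (θ - μ.real E) ^ 2 := pow_le_pow_left₀ (by linarith) (by linarith) 2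
    nlinarith

variable {h d : ℕ}

/-- The number of nodes in a group that hold the opinion `b`. -/
def opinionCount {N : ℕ} (b : Bool) (x : Fin N → Bool) : ℕ :=
  (Finset.univ.filter fun j => x j = b).card

theorem opinionCount_add {N : ℕ} (x : Fin N → Bool) :
    opinionCount true x + opinionCount false x = N := by
  have := Finset.card_filter_add_card_filter_not (s := (Finset.univ : Finset (Fin N)))
    (fun j => x j = true)
  simpa [opinionCount] using this

/-- The response of a node if every adversarial node answers when its opinion differs from `i`
and stays silent otherwise. -/
def extremalResponse (i : Bool) (x : Fin h → Bool) (y : Fin d → Bool) : Node h d → Option Bool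
  | Sum.inl j => some (x j)
  | Sum.inr j => if y j = i then none else some (y j)

/-- With the adversarial opinions fixed, the most `1`s arise when exactly the adversarial nodes with
opinion `1` answer. The bound depends on the queries of `j` alone, however `ans` was chosen. -/
theorem ones_le_extremal (k : ℕ) (x : Fin h → Bool) (y : Fin d → Bool)
    (ans : Fin d → Fin h → ℕ → Bool) (Q : Queries h d) (j : Fin h) :
    onesAmongFirst k (response x y ans Q j)
      ≤ onesAmongFirst k (fun t => extremalResponse false x y (Q j t)) := by
  refine onesAmongFirst_mono _ _ _ (fun t => ?_) fun t => ?_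
  · rcases hq : Q j t with i | i
    · simp [response, extremalResponse, hq]
    · simp only [response, extremalResponse, hq]
      cases y i <;> split_ifs <;> simp_all
  · rcases hq : Q j t with i | i
    · simp [response, extremalResponse, hq]
    · simp only [extremalResponse]
      cases y i <;> simp

theorem extremal_le_ones (k : ℕ) (x : Fin h → Bool) (y : Fin d → Bool)
    (ans : Fin d → Fin h → ℕ → Bool) (Q : Queries h d) (j : Fin h) :
    onesAmongFirst k (fun t => extremalResponse true x y (Q j t))
      ≤ onesAmongFirst k (response x y ans Q j) := by
  refine onesAmongFirst_mono _ _ _ (fun t => ?_) fun t => ?_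
  · rcases hq : Q j t with i | i
    · simp [response, extremalResponse, hq]
    · simp only [extremalResponse]
      cases y i <;> simp
  · rcases hq : Q j t with i | i
    · simp [response, extremalResponse, hq]
    · simp only [response, extremalResponse, hq]
      cases y i <;> split_ifs <;> simp_all

/-- The law of the queries of a single honest node in one round. -/
noncomputable def rowLaw (h d : ℕ) : Measure (ℕ → Node h d) :=
  Measure.infinitePi fun _ : ℕ => uniformOn (Set.univ : Set (Node h d))

theorem isProbabilityMeasure_uniformOn_node (hh : 0 < h) :
    IsProbabilityMeasure (uniformOn (Set.univ : Set (Node h d))) :=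
  isProbabilityMeasure_uniformOn Set.finite_univ ⟨Sum.inl ⟨0, hh⟩, trivial⟩

theorem isProbabilityMeasure_rowLaw (hh : 0 < h) : IsProbabilityMeasure (rowLaw h d) := by
  have := isProbabilityMeasure_uniformOn_node (d := d) hh
  unfold rowLaw
  infer_instance

theorem isProbabilityMeasure_queryLaw (hh : 0 < h) : IsProbabilityMeasure (queryLaw h d) := by
  have := isProbabilityMeasure_rowLaw (d := d) hh
  exact inferInstanceAs (IsProbabilityMeasure (Measure.pi fun _ : Fin h => rowLaw h d))

theorem map_rowLaw (hh : 0 < h) (R : Node h d → Option Bool) :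
    (rowLaw h d).map (fun r t => R (r t))
      = Measure.infinitePi fun _ : ℕ => (uniformOn (Set.univ : Set (Node h d))).map R := by
  have := isProbabilityMeasure_uniformOn_node (d := d) hh
  exact Measure.infinitePi_map_pi _ fun _ => Measurable.of_discrete

theorem uniformOn_map_real (i b : Bool) (x : Fin h → Bool) (y : Fin d → Bool) :
    ((uniformOn (Set.univ : Set (Node h d))).map (extremalResponse i x y)).real {some b}
      = ((opinionCount b x : ℝ) + if b = i then 0 else (opinionCount b y : ℝ)) / (h + d) := by
  have hset : (extremalResponse i x y ⁻¹' {some b}) = ↑(((Finset.univ.filter fun j => x j = b).map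
      Function.Embedding.inl).disjUnion
      ((if b = i then ∅ else (Finset.univ.filter fun j => y j = b)).map
        Function.Embedding.inr) (Finset.disjoint_map_inl_map_inr _ _) : Finset (Node h d)) := by
    ext v
    rcases v with j | j
    · simp [extremalResponse]
    · by_cases hb : b = i
      · subst hb
        simp [extremalResponse]
      · by_cases hy : y j = i
        · simp [extremalResponse, hb, hy, Ne.symm hb]
        · simp [extremalResponse, hb, hy]
  classical
  rw [measureReal_def, Measure.map_apply .of_discrete .of_discrete, hset, uniformOn_univ,
    Measure.count_apply_finset]
  rw [Finset.card_disjUnion, Finset.card_map, Finset.card_map]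
  have hcard : (((Fintype.card (Node h d) : ℕ) : ENNReal)).toReal = (h : ℝ) + d := by
    rw [ENNReal.toReal_natCast]
    simp [Fintype.card_sum]
  rw [ENNReal.toReal_div, hcard, ENNReal.toReal_natCast]
  split_ifs with hb <;> simp [opinionCount]

/-- The probability that a response is `1` if all adversarial nodes with opinion `1` answer and
those with opinion `0` stay silent. -/
noncomputable def upperRate (x : Fin h → Bool) (y : Fin d → Bool) : ℝ :=
  ((opinionCount true x : ℝ) + opinionCount true y) / (h + opinionCount true y)

/-- The probability that a response is `1` if all adversarial nodes with opinion `0` answer and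
those with opinion `1` stay silent. -/
noncomputable def lowerRate (x : Fin h → Bool) (y : Fin d → Bool) : ℝ :=
  (opinionCount true x : ℝ) / (h + opinionCount false y)

theorem measurable_ones_cast (k : ℕ) :
    Measurable fun r : ℕ → Option Bool => (onesAmongFirst k r : ℝ) :=
  (Measurable.of_discrete (f := fun m : ℕ => (m : ℝ))).comp (measurable_onesAmongFirst k)

theorem measurable_extremalResponse_seq (i : Bool) (x : Fin h → Bool) (y : Fin d → Bool) :
    Measurable fun (r : ℕ → Node h d) (t : ℕ) => extremalResponse i x y (r t) :=
  measurable_pi_iff.2 fun t =>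
    (Measurable.of_discrete (f := extremalResponse i x y)).comp (measurable_pi_apply t)

/-- Silent queries are discarded, so the relevant success probability is conditional on an answer;
this ratio is `upperRate`. -/
theorem row_upper_tail (hh : 0 < h) (k : ℕ) (x : Fin h → Bool) (y : Fin d → Bool) (c δ : ℝ)
    (hδ : 0 ≤ δ) (hc : upperRate x y + δ ≤ c) :
    (rowLaw h d).real {r | (k : ℝ) * c ≤
        (onesAmongFirst k (fun t => extremalResponse false x y (r t)) : ℝ)}
      ≤ Real.exp (-2 * k * δ ^ 2) := by
  have := isProbabilityMeasure_uniformOn_node (d := d) hh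
  set κ := (uniformOn (Set.univ : Set (Node h d))).map (extremalResponse false x y) with hκ
  have hκp : IsProbabilityMeasure κ := Measure.isProbabilityMeasure_map .of_discrete
  have hx : (opinionCount true x : ℝ) + opinionCount false x = h := by
    exact_mod_cast opinionCount_add x
  have hpos : (0 : ℝ) < h := by exact_mod_cast hh
  have h1 : κ.real {some true} = ((opinionCount true x : ℝ) + opinionCount true y) / (h + d) := by
    simp [hκ, uniformOn_map_real]
  have h0 : κ.real {some false} = (opinionCount false x : ℝ) / (h + d) := by
    simp [hκ, uniformOn_map_real]
  have hs : κ.real {some true} + κ.real {some false} = (h + opinionCount true y) / (h + d) := by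
    rw [h1, h0, ← add_div]; congr 1; linarith
  have ht := ones_upper_tail κ (by rw [hs]; positivity) k (upperRate x y) c δ
    (le_of_eq (by rw [hs, h1, upperRate]; field_simp)) hδ hc
  rw [hκ, ← map_rowLaw hh, map_measureReal_apply
    (measurable_extremalResponse_seq _ x y)
    (measurableSet_le measurable_const (measurable_ones_cast k))] at ht
  exact ht

theorem row_lower_tail (hh : 0 < h) (k : ℕ) (x : Fin h → Bool) (y : Fin d → Bool) (c δ : ℝ)
    (hδ : 0 ≤ δ) (hc : c ≤ lowerRate x y - δ) :
    (rowLaw h d).real {r |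
        (onesAmongFirst k (fun t => extremalResponse true x y (r t)) : ℝ) ≤ (k : ℝ) * c}
      ≤ Real.exp (-2 * k * δ ^ 2) := by
  have := isProbabilityMeasure_uniformOn_node (d := d) hh
  set κ := (uniformOn (Set.univ : Set (Node h d))).map (extremalResponse true x y) with hκ
  have hκp : IsProbabilityMeasure κ := Measure.isProbabilityMeasure_map .of_discrete
  have hx : (opinionCount true x : ℝ) + opinionCount false x = h := by
    exact_mod_cast opinionCount_add x
  have hpos : (0 : ℝ) < h := by exact_mod_cast hh
  have h1 : κ.real {some true} = (opinionCount true x : ℝ) / (h + d) := by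
    simp [hκ, uniformOn_map_real]
  have h0 : κ.real {some false} = ((opinionCount false x : ℝ) + opinionCount false y) / (h + d) := by
    simp [hκ, uniformOn_map_real]
  have hs : κ.real {some true} + κ.real {some false} = (h + opinionCount false y) / (h + d) := by
    rw [h1, h0, ← add_div]; congr 1; linarith
  have ht := ones_lower_tail κ (by rw [hs]; positivity) k (lowerRate x y) c δ
    (le_of_eq (by rw [hs, h1, lowerRate]; field_simp)) hδ hc
  rw [hκ, ← map_rowLaw hh, map_measureReal_apply
    (measurable_extremalResponse_seq _ x y)
    (measurableSet_le (measurable_ones_cast k) measurable_const)] at ht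
  exact ht

end FPC

/-! ### Dissenting nodes and the stability of near consensus -/

namespace FPC

open ProbabilityTheory

variable {h d : ℕ}

/-- At most the fraction `θ` of the nodes disagrees with the opinion `i`. -/
def NearConsensus {N : ℕ} (θ : ℝ) (i : Bool) (x : Fin N → Bool) : Prop :=
  (opinionCount (!i) x : ℝ) ≤ θ * N

/-- The sequences of queries for which an extremal adversary can make the proportion of `1`s
reach `c` (if `i = 0`), or fall to `c` (if `i = 1`). -/
def dissentSet (k : ℕ) (i : Bool) (x : Fin h → Bool) (y : Fin d → Bool) (c : ℝ) :
    Set (ℕ → Node h d) :=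
  match i with
  | false => {r | (k : ℝ) * c ≤ (onesAmongFirst k (fun t => extremalResponse false x y (r t)) : ℝ)}
  | true => {r | (onesAmongFirst k (fun t => extremalResponse true x y (r t)) : ℝ) ≤ (k : ℝ) * c}

theorem measurableSet_dissentSet (k : ℕ) (i : Bool) (x : Fin h → Bool) (y : Fin d → Bool) (c : ℝ) :
    MeasurableSet (dissentSet k i x y c) := by
  cases i
  · exact measurableSet_le measurable_const
      ((measurable_ones_cast k).comp (measurable_extremalResponse_seq false x y))
  · exact measurableSet_le
      ((measurable_ones_cast k).comp (measurable_extremalResponse_seq true x y)) measurable_const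

/-- The outcome of the decision rule for the node `j`. -/
noncomputable def decision (k : ℕ) (x : Fin h → Bool) (y : Fin d → Bool)
    (ans : Fin d → Fin h → ℕ → Bool) (r : RoundData h d) (j : Fin h) : Bool :=
  open Classical in
  decide (r.2 ≤ (onesAmongFirst k (response x y ans r.1 j) : ℝ) / (k : ℝ))

/-- Replaces a decision, which may depend on all queries through `ans`, by an event about row `j`
only. Independence over the nodes becomes available in this way. -/
theorem mem_dissentSet_false {k : ℕ} (hk : 1 ≤ k) (x : Fin h → Bool) (y : Fin d → Bool)
    (ans : Fin d → Fin h → ℕ → Bool) (r : RoundData h d) (j : Fin h) (c : ℝ) (hc : c ≤ r.2)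
    (hj : decision k x y ans r j = true) : r.1 j ∈ dissentSet k false x y c := by
  have hk' : (0 : ℝ) < k := by exact_mod_cast hk
  have h1 := of_decide_eq_true hj
  have h2 : ((onesAmongFirst k (response x y ans r.1 j) : ℕ) : ℝ)
      ≤ onesAmongFirst k (fun t => extremalResponse false x y (r.1 j t)) := by
    exact_mod_cast ones_le_extremal k x y ans r.1 j
  rw [le_div_iff₀ hk'] at h1
  change (k : ℝ) * c ≤ _
  nlinarith

theorem mem_dissentSet_true {k : ℕ} (hk : 1 ≤ k) (x : Fin h → Bool) (y : Fin d → Bool)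
    (ans : Fin d → Fin h → ℕ → Bool) (r : RoundData h d) (j : Fin h) (c : ℝ) (hc : r.2 ≤ c)
    (hj : decision k x y ans r j = false) : r.1 j ∈ dissentSet k true x y c := by
  have hk' : (0 : ℝ) < k := by exact_mod_cast hk
  have h1 := of_decide_eq_false hj
  have h2 : ((onesAmongFirst k (fun t => extremalResponse true x y (r.1 j t)) : ℕ) : ℝ)
      ≤ onesAmongFirst k (response x y ans r.1 j) := by
    exact_mod_cast extremal_le_ones k x y ans r.1 j
  rw [not_le, div_lt_iff₀ hk'] at h1
  change _ ≤ (k : ℝ) * c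
  nlinarith

/-- The number of nodes whose sequence of queries lies in `E`. -/
noncomputable def rowCount (E : Set (ℕ → Node h d)) (Q : Queries h d) : ℕ :=
  open Classical in (Finset.univ.filter fun j => Q j ∈ E).card

theorem measurable_rowCount {E : Set (ℕ → Node h d)} (hE : MeasurableSet E) :
    Measurable (rowCount E) := by
  classical
  unfold rowCount
  simp only [Finset.card_filter]
  refine Finset.measurable_sum _ fun j _ => ?_
  exact Measurable.ite (measurable_pi_apply j hE) measurable_const measurable_const

theorem rowCount_tail (hh : 0 < h) {E : Set (ℕ → Node h d)} (hE : MeasurableSet E) (p θ : ℝ)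
    (hp : (rowLaw h d).real E ≤ p) (hpθ : p ≤ θ) :
    (queryLaw h d).real {Q | θ * h < (rowCount E Q : ℝ)} ≤ Real.exp (-2 * h * (θ - p) ^ 2) := by
  classical
  have := isProbabilityMeasure_rowLaw (d := d) hh
  have hp := pi_count_tail (rowLaw h d) h hh E hE p θ hp hpθ
  unfold rowCount
  convert hp
  rfl

theorem opinionCount_le_rowCount (E : Set (ℕ → Node h d)) (Q : Queries h d) (b : Bool)
    (x : Fin h → Bool) (hx : ∀ j, x j = b → Q j ∈ E) : opinionCount b x ≤ rowCount E Q := by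
  classical
  unfold opinionCount rowCount
  exact Finset.card_le_card (Finset.monotone_filter_right _ fun j _ => hx j)

/-- The extremal value of the later thresholds that is the most dangerous one for the
opinion `i`. -/
def extremeThreshold (β : ℝ) (i : Bool) : ℝ := if i then 1 - β else β

theorem mem_dissentSet_of_ne {k : ℕ} (hk : 1 ≤ k) (x : Fin h → Bool) (y : Fin d → Bool)
    (ans : Fin d → Fin h → ℕ → Bool) (r : RoundData h d) (j : Fin h) (β : ℝ) (i : Bool)
    (hr : r.2 ∈ Set.Icc β (1 - β)) (hj : decision k x y ans r j ≠ i) :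
    r.1 j ∈ dissentSet k i x y (extremeThreshold β i) := by
  cases i
  · exact mem_dissentSet_false hk x y ans r j _ (by simpa [extremeThreshold] using hr.1)
      (by simpa using hj)
  · exact mem_dissentSet_true hk x y ans r j _ (by simpa [extremeThreshold] using hr.2)
      (by simpa using hj)

section Rates

variable {q β : ℝ}

theorem one_sub_mul_eq (hh : 0 < h) (hq : q = (d : ℝ) / ((h : ℝ) + d))
    : (1 - q) * ((h : ℝ) + d) = h := by
  have hpos : (0 : ℝ) < h := by exact_mod_cast hh
  rw [hq]; field_simp; ring

theorem q_nonneg (hh : 0 < h) (hq : q = (d : ℝ) / ((h : ℝ) + d))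
    : 0 ≤ q := by rw [hq]; positivity

theorem q_lt_one (hh : 0 < h) (hq : q = (d : ℝ) / ((h : ℝ) + d))
    : q < 1 := by
  have hpos : (0 : ℝ) < h := by exact_mod_cast hh
  rw [hq, div_lt_one (by positivity)]; linarith

theorem threshold_mul_eq (hh : 0 < h) (hq : q = (d : ℝ) / ((h : ℝ) + d))
    : (β - q) / (2 * (1 - q)) * h = (β - q) / 2 * ((h : ℝ) + d) := by
  have h1 := q_lt_one hh hq
  have e := one_sub_mul_eq hh hq
  have : 1 - q ≠ 0 := by linarith
  field_simp
  linear_combination -(β - q) * e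

/-- The rate increases with the number of answering adversarial nodes, so the worst case is that all
`d` answer, and (β-q)/2 + q = (β+q)/2. -/
theorem upperRate_le (hh : 0 < h) (hq : q = (d : ℝ) / ((h : ℝ) + d))
    (x : Fin h → Bool) (y : Fin d → Bool)
    (hx : NearConsensus ((β - q) / (2 * (1 - q))) false x) : upperRate x y ≤ (β + q) / 2 := by
  have hpos : (0 : ℝ) < h := by exact_mod_cast hh
  have hd : (0 : ℝ) ≤ d := Nat.cast_nonneg d
  unfold NearConsensus at hx
  rw [threshold_mul_eq hh hq] at hx
  simp only [Bool.not_false] at hx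
  have hxh : (opinionCount true x : ℝ) ≤ h := by
    have := opinionCount_add x
    exact_mod_cast (by omega : opinionCount true x ≤ h)
  have hyd : (opinionCount true y : ℝ) ≤ d := by
    have := opinionCount_add y
    exact_mod_cast (by omega : opinionCount true y ≤ d)
  have hy0 : (0 : ℝ) ≤ opinionCount true y := Nat.cast_nonneg _
  have hqn : q * ((h : ℝ) + d) = d := by rw [hq]; field_simp
  have step : upperRate x y ≤ ((opinionCount true x : ℝ) + d) / (h + d) := by
    unfold upperRate
    rw [div_le_div_iff₀ (by positivity) (by positivity)]
    nlinarith
  refine step.trans ?_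
  rw [div_le_iff₀ (by positivity)]
  linarith

theorem le_lowerRate (hh : 0 < h) (hq : q = (d : ℝ) / ((h : ℝ) + d))
    (x : Fin h → Bool) (y : Fin d → Bool)
    (hx : NearConsensus ((β - q) / (2 * (1 - q))) true x) :
    1 - (β + q) / 2 ≤ lowerRate x y := by
  have hpos : (0 : ℝ) < h := by exact_mod_cast hh
  have hd : (0 : ℝ) ≤ d := Nat.cast_nonneg d
  unfold NearConsensus at hx
  rw [threshold_mul_eq hh hq] at hx
  simp only [Bool.not_true] at hx
  have hxa : (opinionCount true x : ℝ) + opinionCount false x = h := by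
    exact_mod_cast opinionCount_add x
  have hyd : (opinionCount false y : ℝ) ≤ d := by
    have := opinionCount_add y
    exact_mod_cast (by omega : opinionCount false y ≤ d)
  have hy0 : (0 : ℝ) ≤ opinionCount false y := Nat.cast_nonneg _
  have hx0 : (0 : ℝ) ≤ opinionCount true x := Nat.cast_nonneg _
  have hqn : q * ((h : ℝ) + d) = d := by rw [hq]; field_simp
  have step : (opinionCount true x : ℝ) / (h + d) ≤ lowerRate x y := by
    unfold lowerRate
    exact div_le_div_of_nonneg_left hx0 (by positivity) (by linarith)
  refine le_trans ?_ step
  rw [le_div_iff₀ (by positivity)]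
  linarith

/-- The extremal rate keeps the distance (β-q)/2 from the worst threshold, and ε is Hoeffding's
bound for this deviation. -/
theorem dissent_prob_le (hh : 0 < h) (hq : q = (d : ℝ) / ((h : ℝ) + d))
    (k : ℕ) (hqβ : q < β) (i : Bool) (x : Fin h → Bool) (y : Fin d → Bool)
    (hx : NearConsensus ((β - q) / (2 * (1 - q))) i x) :
    (rowLaw h d).real (dissentSet k i x y (extremeThreshold β i)) ≤ errProb β q k := by
  have e : errProb β q k = Real.exp (-2 * k * ((β - q) / 2) ^ 2) := by
    unfold errProb; congr 1; ring
  rw [e]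
  cases i
  · have := upperRate_le hh hq x y hx
    exact row_upper_tail hh k x y _ _ (by linarith) (by simp [extremeThreshold]; linarith)
  · have := le_lowerRate hh hq x y hx
    exact row_lower_tail hh k x y _ _ (by linarith) (by simp [extremeThreshold]; linarith)

theorem nearConsensus_lost_prob_le (hh : 0 < h) (hq : q = (d : ℝ) / ((h : ℝ) + d))
    (k : ℕ) (hqβ : q < β) (hφ : 0 < phi β q k) (i : Bool)
    (x : Fin h → Bool) (y : Fin d → Bool)
    (hx : NearConsensus ((β - q) / (2 * (1 - q))) i x) :
    (queryLaw h d).real {Q | (β - q) / (2 * (1 - q)) * h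
        < (rowCount (dissentSet k i x y (extremeThreshold β i)) Q : ℝ)}
      ≤ Real.exp (-2 * h * phi β q k ^ 2) := by
  unfold phi at hφ ⊢
  exact rowCount_tail hh (measurableSet_dissentSet _ _ _ _ _) _ _
    (dissent_prob_le hh hq k hqβ i x y hx) (by linarith)

/-- The margin around the interval controlled by the adversary. -/
noncomputable def margin (β q : ℝ) (k : ℕ) : ℝ :=
  Real.sqrt (2 * (k : ℝ)⁻¹ * Real.log (4 * (1 - q) / (β - q))) / 2

theorem margin_nonneg (β q : ℝ) (k : ℕ) : 0 ≤ margin β q k := by unfold margin; positivity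

/-- The margin is chosen so that a single row dissents with probability at most θ/2, half of the
fraction allowed by near consensus. -/
theorem exp_margin {k : ℕ} (hk : 1 ≤ k) (hqβ : q < β) (hβ : β < 1) :
    Real.exp (-2 * k * margin β q k ^ 2) = (β - q) / (2 * (1 - q)) / 2 := by
  have hk' : (0 : ℝ) < k := by exact_mod_cast hk
  have h1 : 0 < β - q := by linarith
  have h2 : 0 < 1 - q := by linarith
  have hlog : 0 ≤ Real.log (4 * (1 - q) / (β - q)) :=
    Real.log_nonneg (by rw [le_div_iff₀ h1]; linarith)
  unfold margin
  rw [div_pow, Real.sq_sqrt (by positivity)]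
  have : -2 * (k : ℝ) * (2 * (k : ℝ)⁻¹ * Real.log (4 * (1 - q) / (β - q)) / 2 ^ 2)
      = -Real.log (4 * (1 - q) / (β - q)) := by field_simp
  rw [this, Real.exp_neg, Real.exp_log (by positivity)]
  field_simp
  norm_num

theorem dissent_count_prob_le (hh : 0 < h) (hq : q = (d : ℝ) / ((h : ℝ) + d))
    {k : ℕ} (hk : 1 ≤ k) (hqβ : q < β) (hβ : β < 1) (i : Bool)
    (x : Fin h → Bool) (y : Fin d → Bool) (c : ℝ)
    (hc : if i then c ≤ lowerRate x y - margin β q k else upperRate x y + margin β q k ≤ c) :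
    (queryLaw h d).real {Q | (β - q) / (2 * (1 - q)) * h < (rowCount (dissentSet k i x y c) Q : ℝ)}
      ≤ Real.exp (-(1 / 8) * ((h : ℝ) + d) * ((β - q) ^ 2 / (4 * (1 - q)))) := by
  have h2 : 0 < 1 - q := by linarith
  have h1 : 0 < β - q := by linarith
  have hrow : (rowLaw h d).real (dissentSet k i x y c) ≤ (β - q) / (2 * (1 - q)) / 2 := by
    rw [← exp_margin hk hqβ hβ]
    cases i
    · exact row_upper_tail hh k x y _ _ (margin_nonneg _ _ _) (by simpa using hc)
    · exact row_lower_tail hh k x y _ _ (margin_nonneg _ _ _) (by simpa using hc)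
  refine (rowCount_tail hh (measurableSet_dissentSet _ _ _ _ _) _ _ hrow
    (half_le_self (by positivity))).trans ?_
  have e := one_sub_mul_eq hh hq
  have hn : (0 : ℝ) ≤ (h : ℝ) + d := by positivity
  rw [Real.exp_le_exp]
  generalize (h : ℝ) + d = n at e hn ⊢
  rw [← e]
  have : -2 * ((1 - q) * n) * ((β - q) / (2 * (1 - q)) - (β - q) / (2 * (1 - q)) / 2) ^ 2
      = -(1 / 2) * n * ((β - q) ^ 2 / (4 * (1 - q))) := by
    field_simp; ring
  rw [this]
  -- The remaining gap θ/2 gives the constant 1/2 in the exponent; the stated 1/8 is weaker.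
  have : 0 ≤ n * ((β - q) ^ 2 / (4 * (1 - q))) := by positivity
  linarith

end Rates

end FPC

/-! ### Random thresholds, the interval controlled by the adversary, and the comparison of
`failProb` with `psiSemi` -/

namespace FPC

open ProbabilityTheory

instance instIsProbabilityMeasureUniformLaw (x y : ℝ) : IsProbabilityMeasure (uniformLaw x y) := by
  have : IsProbabilityMeasure ((volume : Measure ℝ).restrict (Set.Icc 0 1)) := ⟨by simp⟩
  exact Measure.isProbabilityMeasure_map (by fun_prop)

instance instIsProbabilityMeasureThresholdLaw (π : Params) (m : ℕ) :
    IsProbabilityMeasure (thresholdLaw π m) := by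
  unfold thresholdLaw; split_ifs <;> infer_instance

theorem uniformLaw_ae_mem {x y : ℝ} (hxy : x ≤ y) : ∀ᵐ t ∂(uniformLaw x y), t ∈ Set.Icc x y := by
  unfold uniformLaw
  refine (ae_map_iff (p := fun t => t ∈ Set.Icc x y) (by fun_prop) measurableSet_Icc).2 ?_
  filter_upwards [ae_restrict_mem measurableSet_Icc] with t ht
  constructor <;> nlinarith [ht.1, ht.2]

theorem uniformLaw_real_Icc_le {x y : ℝ} (hxy : x < y) (l u c : ℝ) (hc : 0 ≤ c)
    (h : min u y - max l x ≤ c) : (uniformLaw x y).real (Set.Icc l u) ≤ c / (y - x) := by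
  have hpos : 0 < y - x := sub_pos.2 hxy
  unfold uniformLaw
  rw [map_measureReal_apply (by fun_prop) measurableSet_Icc, measureReal_restrict_apply
    ((by fun_prop : Measurable fun t : ℝ => x + (y - x) * t) measurableSet_Icc)]
  have hsub : (fun t : ℝ => x + (y - x) * t) ⁻¹' Set.Icc l u ∩ Set.Icc 0 1
      ⊆ Set.Icc ((max l x - x) / (y - x)) ((min u y - x) / (y - x)) := by
    rintro t ⟨⟨h1, h2⟩, h3, h4⟩
    have h5 : 0 ≤ (y - x) * t := mul_nonneg hpos.le h3
    have h6 : (y - x) * t ≤ y - x := mul_le_of_le_one_right hpos.le h4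
    constructor
    · rw [div_le_iff₀ hpos, sub_le_iff_le_add]
      exact max_le (by linarith) (by linarith)
    · rw [le_div_iff₀ hpos, le_sub_iff_add_le]
      exact le_min (by linarith) (by linarith)
  refine (measureReal_mono hsub (by simp)).trans ?_
  rw [measureReal_def, Real.volume_Icc, ← sub_div]
  refine ENNReal.toReal_le_of_le_ofReal (by positivity) (ENNReal.ofReal_le_ofReal ?_)
  gcongr
  linarith

/-- Here `c` is the share of honest `1`s, and `q0`, `q1` are the shares of the two adversarial
opinions. If `q0 ≤ q1`, the upper endpoint grows more slowly with `c` than the lower one, so the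
clipped length is largest when the lower endpoint is at β. The other case follows by exchanging the
opinions. -/
theorem clipped_interval_le {a q q0 q1 β c : ℝ} (ha : a = 1 - q) (hq : q0 + q1 = q) (hq0 : 0 ≤ q0)
    (hq1 : 0 ≤ q1) (hqlt : q < 1) (hc1 : c ≤ a)
    (hβq : β * (2 - q) ≤ 1 - q) :
    min ((c + q1) / (a + q1)) (1 - β) - max (c / (a + q0)) β ≤ q * (1 - β) := by
  subst ha
  have hp1 : 0 < 1 - q + q1 := by linarith
  have hp0 : 0 < 1 - q + q0 := by linarith
  have hβh : β ≤ 1 / 2 := by nlinarith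
  rcases le_total q0 q1 with hle | hle
  · have h1 := min_le_left ((c + q1) / (1 - q + q1)) (1 - β)
    -- After clearing denominators the difference is exactly (q - q1)(1 - 2β - q(1-β)). The second
    -- factor is (1-q) - β(2-q), and equality holds at `q1 = q`.
    have hend : (β * (1 - q + q0) + q1) / (1 - q + q1) - β ≤ q * (1 - β) := by
      rw [sub_le_iff_le_add, div_le_iff₀ hp1]
      obtain rfl : q0 = q - q1 := by linarith
      nlinarith [mul_nonneg (sub_nonneg.2 (by linarith : q1 ≤ q)) (by nlinarith : 0 ≤ 1 - 2 * β - q * (1 - β))]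
    rcases le_total (c / (1 - q + q0)) β with hcb | hcb
    · have h2 := le_max_right (c / (1 - q + q0)) β
      have h3 : c ≤ β * (1 - q + q0) := (div_le_iff₀ hp0).1 hcb
      have : (c + q1) / (1 - q + q1) ≤ (β * (1 - q + q0) + q1) / (1 - q + q1) := by gcongr
      linarith
    · have h2 := le_max_left (c / (1 - q + q0)) β
      have h3 : β * (1 - q + q0) ≤ c := (le_div_iff₀ hp0).1 hcb
      have : (c - β * (1 - q + q0)) / (1 - q + q1) ≤ (c - β * (1 - q + q0)) / (1 - q + q0) := by
        gcongr
      have e1 : (c - β * (1 - q + q0)) / (1 - q + q0) = c / (1 - q + q0) - β := by field_simp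
      have e2 : (c - β * (1 - q + q0)) / (1 - q + q1)
          = (c + q1) / (1 - q + q1) - (β * (1 - q + q0) + q1) / (1 - q + q1) := by ring
      linarith
  · have h1 := le_max_left (c / (1 - q + q0)) β
    -- `z` is the share of honest `0`s, which plays the role of `c` after the exchange of opinions.
    set z := 1 - q - c with hz
    have e0 : c / (1 - q + q0) = 1 - (z + q0) / (1 - q + q0) := by
      rw [hz]; field_simp; ring
    have e1 : (c + q1) / (1 - q + q1) = 1 - z / (1 - q + q1) := by
      rw [hz]; field_simp; ring
    have hend : (β * (1 - q + q1) + q0) / (1 - q + q0) - β ≤ q * (1 - β) := by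
      rw [sub_le_iff_le_add, div_le_iff₀ hp0]
      obtain rfl : q1 = q - q0 := by linarith
      nlinarith [mul_nonneg (sub_nonneg.2 (by linarith : q0 ≤ q)) (by nlinarith : 0 ≤ 1 - 2 * β - q * (1 - β))]
    rcases le_total (z / (1 - q + q1)) β with hcb | hcb
    · have h2 := min_le_right ((c + q1) / (1 - q + q1)) (1 - β)
      have h3 : z ≤ β * (1 - q + q1) := (div_le_iff₀ hp1).1 hcb
      have : (z + q0) / (1 - q + q0) ≤ (β * (1 - q + q1) + q0) / (1 - q + q0) := by gcongr
      linarith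
    · have h2 := min_le_left ((c + q1) / (1 - q + q1)) (1 - β)
      have h3 : β * (1 - q + q1) ≤ z := (le_div_iff₀ hp1).1 hcb
      have : (z - β * (1 - q + q1)) / (1 - q + q0) ≤ (z - β * (1 - q + q1)) / (1 - q + q1) := by
        gcongr
      have e3 : (z - β * (1 - q + q1)) / (1 - q + q1) = z / (1 - q + q1) - β := by field_simp
      have e2 : (z - β * (1 - q + q1)) / (1 - q + q0)
          = (z + q0) / (1 - q + q0) - (β * (1 - q + q1) + q0) / (1 - q + q0) := by ring
      linarith

variable {h d : ℕ} {q β : ℝ}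

theorem controlled_interval_le (hh : 0 < h) (hq : q = (d : ℝ) / ((h : ℝ) + d))
    (hβq : β * (2 - q) ≤ 1 - q) (x : Fin h → Bool) (y : Fin d → Bool) :
    min (upperRate x y) (1 - β) - max (lowerRate x y) β ≤ q * (1 - β) := by
  have hpos : (0 : ℝ) < h := by exact_mod_cast hh
  have hn : (0 : ℝ) < (h : ℝ) + d := by positivity
  have e := one_sub_mul_eq hh hq
  have hy : (opinionCount true y : ℝ) + opinionCount false y = d := by
    exact_mod_cast opinionCount_add y
  have hx : (opinionCount true x : ℝ) + opinionCount false x = h := by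
    exact_mod_cast opinionCount_add x
  have key := clipped_interval_le (a := 1 - q) (q := q) (q0 := opinionCount false y / ((h : ℝ) + d))
    (q1 := opinionCount true y / ((h : ℝ) + d)) (β := β) (c := opinionCount true x / ((h : ℝ) + d))
    rfl (by rw [← add_div, add_comm, hy, hq]) (by positivity) (by positivity) (q_lt_one hh hq) (by
      rw [div_le_iff₀ hn, e]
      have : (0 : ℝ) ≤ opinionCount false x := Nat.cast_nonneg _
      linarith) hβq
  have e1 : (opinionCount true x / ((h : ℝ) + d) + opinionCount true y / ((h : ℝ) + d))
      / (1 - q + opinionCount true y / ((h : ℝ) + d)) = upperRate x y := by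
    have : 1 - q = h / ((h : ℝ) + d) := by rw [eq_div_iff hn.ne', e]
    unfold upperRate
    rw [this]; field_simp
  have e0 : opinionCount true x / ((h : ℝ) + d) / (1 - q + opinionCount false y / ((h : ℝ) + d))
      = lowerRate x y := by
    have : 1 - q = h / ((h : ℝ) + d) := by rw [eq_div_iff hn.ne', e]
    unfold lowerRate
    rw [this]; field_simp
  rwa [e1, e0] at key

/-- A bound for the probability that a round with a random threshold does not bring the honest
nodes close to consensus. -/
noncomputable def failProb (β q : ℝ) (n k : ℕ) : ℝ :=
  2 * Real.exp (-(1 / 8) * n * ((β - q) ^ 2 / (4 * (1 - q))))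
    + (q * (1 - β) + 2 * margin β q k) / (1 - 2 * β)

/-- Compares the leading terms of `failProb` and `psiSemi`; the exponents 2 and 3 are what allows
one round to be gained when m₀ ≥ 3. -/
theorem sq_le_cube_of_rates {q β : ℝ} (hq0 : 0 ≤ q) (hq1 : q ≤ 3 / 8 + 1 / 100) (hβ : β < 1 / 2)
    (hβq : β * (2 - q) ≤ 1 - q) :
    (q * (1 - β) / (1 - 2 * β)) ^ 2 ≤ ((1 / (2 - q) - β) / (1 - 2 * β)) ^ 3 := by
  have hw : 0 < 1 - 2 * β := by linarith
  have hc : 0 < 2 - q := by linarith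
  -- `s` is twice the slack in `hβq`. At `s = 0` both ratios are 1, and otherwise the cleared
  -- difference is `s` times a quadratic in `s` whose coefficients are nonnegative in the given
  -- range of `q`.
  obtain ⟨s, hs⟩ : ∃ s, s = (2 - q) * (1 - 2 * β) - q := ⟨_, rfl⟩
  have hs0 : 0 ≤ s := by rw [hs]; nlinarith
  have hβs : β = (1 - (q + s) / (2 - q)) / 2 := by rw [hs]; field_simp; ring
  have e1 : 1 - 2 * β = (q + s) / (2 - q) := by rw [hβs]; ring
  have hqs : 0 < q + s := by
    have := mul_pos hc hw
    linarith
  have e2 : q * (1 - β) / (1 - 2 * β) = q * (2 + s) / (2 * (q + s)) := by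
    rw [e1, hβs]; field_simp; ring
  have e3 : (1 / (2 - q) - β) / (1 - 2 * β) = (2 * q + s) / (2 * (q + s)) := by
    rw [e1, hβs]; field_simp; ring
  rw [e2, e3, div_pow, div_pow, div_le_div_iff₀ (by positivity) (by positivity)]
  have main : 2 * q ^ 2 * (q + s) * (2 + s) ^ 2 ≤ (2 * q + s) ^ 3 := by
    have i1 : 0 ≤ 4 * q ^ 2 - 8 * q ^ 3 := by nlinarith [sq_nonneg q]
    have i2 : 0 ≤ 6 * q - 8 * q ^ 2 - 2 * q ^ 3 := by
      have : 0 ≤ 6 - 8 * q - 2 * q ^ 2 := by nlinarith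
      nlinarith
    have i3 : 0 ≤ 1 - 2 * q ^ 2 := by nlinarith
    have : 0 ≤ s * ((4 * q ^ 2 - 8 * q ^ 3) + (6 * q - 8 * q ^ 2 - 2 * q ^ 3) * s
        + (1 - 2 * q ^ 2) * s ^ 2) := by positivity
    nlinarith
  have := mul_le_mul_of_nonneg_right main (by positivity : 0 ≤ (2 * (q + s)) ^ 2)
  nlinarith

theorem q_bound_of_control {k : ℕ} (hqβ : q < β) (hβ : β < 1 / 2)
    (hcontrol : controlLength β q k < 1 - 2 * β) : β * (2 - q) ≤ 1 - q := by
  unfold controlLength at hcontrol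
  have h0 := Real.sqrt_nonneg (2 * (k : ℝ)⁻¹ * Real.log (4 * (1 - q) / (β - q)))
  have hc : 0 < 2 - q := by linarith
  have : 1 / (2 - q) < 1 - β := by linarith
  rw [div_lt_iff₀ hc] at this
  nlinarith

theorem failProb_le_psiSemi {k : ℕ} (n : ℕ) (hqβ : q < β) (hβ : β < 1 / 2)
    (hcontrol : controlLength β q k < 1 - 2 * β) : failProb β q n k ≤ psiSemi β q n k := by
  have hb := q_bound_of_control hqβ hβ hcontrol
  have hc : 0 < 2 - q := by linarith
  have hw : 0 < 1 - 2 * β := by linarith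
  unfold failProb psiSemi controlLength margin
  have : q * (1 - β) ≤ 1 / (2 - q) - β := by
    -- By `hb`, (q + β(1-q))(2-q) ≤ q(2-q) + (1-q)² = 1.
    rw [le_sub_iff_add_le, le_div_iff₀ hc]
    nlinarith
  gcongr
  linarith

/-- The two quantities are x + t and y + t with the same t ≥ 0. The expansion of (y+t)³ - (x+t)² has
nonnegative coefficients, because x² ≤ y³, 2x ≤ 3y² and y ≥ 1/2. -/
theorem failProb_sq_le {k : ℕ} (n : ℕ) (hq0 : 0 ≤ q) (hqβ : q < β) (hβ : β < 1 / 2)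
    (hcontrol : controlLength β q k < 1 - 2 * β) :
    failProb β q n k ^ 2 ≤ psiSemi β q n k ^ 3 := by
  have hb := q_bound_of_control hqβ hβ hcontrol
  have hw : 0 < 1 - 2 * β := by linarith
  -- From q < β and `hb`, q² - 3q + 1 > 0, so q lies below (3-√5)/2 ≈ 0.382.
  have hq1 : q ≤ 3 / 8 + 1 / 100 := by nlinarith
  have hc : 0 < 2 - q := by linarith
  have key := sq_le_cube_of_rates hq0 hq1 hβ hb
  set x := q * (1 - β) / (1 - 2 * β) with hx
  set y := (1 / (2 - q) - β) / (1 - 2 * β) with hy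
  set t := 2 * Real.exp (-(1 / 8) * n * ((β - q) ^ 2 / (4 * (1 - q))))
    + 2 * margin β q k / (1 - 2 * β) with ht
  have ht0 : 0 ≤ t := by
    have := margin_nonneg β q k
    rw [ht]; positivity
  have ef : failProb β q n k = x + t := by unfold failProb; rw [hx, ht]; ring
  have ep : psiSemi β q n k = y + t := by
    unfold psiSemi controlLength; rw [hy, ht, margin]; ring
  have hx0 : 0 ≤ x := div_nonneg (mul_nonneg hq0 (by linarith)) hw.le
  have hy1 : 1 / 2 ≤ y := by
    rw [hy, le_div_iff₀ hw]
    have : 1 / 2 ≤ 1 / (2 - q) := one_div_le_one_div_of_le hc (by linarith)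
    linarith
  -- Compare squares: 4x² ≤ 4y³ ≤ 9y⁴, since y ≥ 1/2 > 4/9.
  have h2x : 2 * x ≤ 3 * y ^ 2 := by
    refine abs_le_of_sq_le_sq' ?_ (by positivity) |>.2
    nlinarith [pow_pos (by linarith : 0 < y) 3]
  rw [ef, ep]
  have i1 : 0 ≤ (3 * y ^ 2 - 2 * x) * t := mul_nonneg (by linarith) ht0
  have i2 : 0 ≤ (3 * y - 1) * t ^ 2 := mul_nonneg (by linarith) (sq_nonneg t)
  have i3 : 0 ≤ t ^ 3 := by positivity
  nlinarith

theorem failProb_nonneg {k : ℕ} (n : ℕ) (hq0 : 0 ≤ q) (hβ : β < 1 / 2) :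
    0 ≤ failProb β q n k := by
  have hw : 0 < 1 - 2 * β := by linarith
  have := margin_nonneg β q k
  have : 0 ≤ q * (1 - β) := mul_nonneg hq0 (by linarith)
  unfold failProb; positivity

/-- Squaring and f² ≤ ψ³ reduce this to 3(m-1) ≥ 2m, which is m ≥ 3. It makes up for the round lost
at the start. -/
theorem failProb_pow_le {k : ℕ} (n m : ℕ) (hm : 3 ≤ m) (hq0 : 0 ≤ q) (hqβ : q < β)
    (hβ : β < 1 / 2) (hcontrol : controlLength β q k < 1 - 2 * β) (h1 : psiSemi β q n k ≤ 1) :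
    failProb β q n k ^ (m - 1) ≤ psiSemi β q n k ^ m := by
  have hf := failProb_nonneg (k := k) n hq0 hβ
  have hψ : 0 ≤ psiSemi β q n k := hf.trans (failProb_le_psiSemi n hqβ hβ hcontrol)
  refine abs_le_of_sq_le_sq' ?_ (by positivity) |>.2
  calc (failProb β q n k ^ (m - 1)) ^ 2 = (failProb β q n k ^ 2) ^ (m - 1) := by
        rw [← pow_mul, ← pow_mul, mul_comm]
    _ ≤ (psiSemi β q n k ^ 3) ^ (m - 1) :=
        pow_le_pow_left₀ (by positivity) (failProb_sq_le n hq0 hqβ hβ hcontrol) _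
    _ = psiSemi β q n k ^ (3 * (m - 1)) := by rw [← pow_mul]
    _ ≤ psiSemi β q n k ^ (m * 2) := pow_le_pow_of_le_one hψ h1 (by omega)
    _ = (psiSemi β q n k ^ m) ^ 2 := by rw [pow_mul]

end FPC

/-! ### One-round estimates for a fixed past -/

namespace FPC

open ProbabilityTheory

variable {h d : ℕ} {q : ℝ}

/-- The law of the randomness of the round `m + 1`. -/
noncomputable def roundLaw (π : Params) (h d m : ℕ) : Measure (RoundData h d) :=
  (queryLaw h d).prod (thresholdLaw π m)

theorem isProbabilityMeasure_roundLaw (hh : 0 < h) (π : Params) (m : ℕ) :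
    IsProbabilityMeasure (roundLaw π h d m) := by
  have := isProbabilityMeasure_queryLaw (d := d) hh
  unfold roundLaw
  infer_instance

theorem roundLaw_real_fst (hh : 0 < h) (π : Params) (m : ℕ) {E : Set (Queries h d)} :
    (roundLaw π h d m).real {r | r.1 ∈ E} = (queryLaw h d).real E := by
  have := isProbabilityMeasure_queryLaw (d := d) hh
  have : {r : RoundData h d | r.1 ∈ E} = E ×ˢ Set.univ := by ext; simp
  rw [this, roundLaw, measureReal_prod_prod, probReal_univ, mul_one]

theorem roundLaw_real_snd (hh : 0 < h) (π : Params) (m : ℕ) {E : Set ℝ} :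
    (roundLaw π h d m).real {r | r.2 ∈ E} = (thresholdLaw π m).real E := by
  have := isProbabilityMeasure_queryLaw (d := d) hh
  have : {r : RoundData h d | r.2 ∈ E} = Set.univ ×ˢ E := by ext; simp
  rw [this, roundLaw, measureReal_prod_prod, probReal_univ, one_mul]

theorem roundLaw_real_row (hh : 0 < h) (π : Params) (m : ℕ) (j : Fin h)
    {E : Set (ℕ → Node h d)} (hE : MeasurableSet E) :
    (roundLaw π h d m).real {r | r.1 j ∈ E} = (rowLaw h d).real E := by
  have := isProbabilityMeasure_rowLaw (d := d) hh
  have e := (measurePreserving_eval (fun _ : Fin h => rowLaw h d) j).measureReal_preimage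
    hE.nullMeasurableSet
  rw [← e]
  exact roundLaw_real_fst hh π m (E := {Q | Q j ∈ E})

theorem roundLaw_ae_threshold (hh : 0 < h) (π : Params) (hβ : π.β < 1 / 2) {m : ℕ} (hm : m ≠ 0) :
    ∀ᵐ r ∂(roundLaw π h d m), r.2 ∈ Set.Icc π.β (1 - π.β) := by
  have := isProbabilityMeasure_queryLaw (d := d) hh
  have h1 : ∀ᵐ t ∂(thresholdLaw π m), t ∈ Set.Icc π.β (1 - π.β) := by
    unfold thresholdLaw
    rw [if_neg hm]
    exact uniformLaw_ae_mem (by linarith)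
  exact (Measure.quasiMeasurePreserving_snd (μ := queryLaw h d)
    (ν := thresholdLaw π m)).ae h1

theorem not_nearConsensus_imp (θ : ℝ) (i : Bool) (x : Fin h → Bool) (E : Set (ℕ → Node h d))
    (Q : Queries h d) (hx : ∀ j, x j ≠ i → Q j ∈ E) (hn : ¬ NearConsensus θ i x) :
    θ * h < (rowCount E Q : ℝ) := by
  unfold NearConsensus at hn
  rw [not_le] at hn
  refine hn.trans_le ?_
  exact_mod_cast opinionCount_le_rowCount E Q (!i) x fun j hj => hx j (by rw [hj]; simp)

/-- Closeness to consensus is preserved in a round with high probability. -/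
theorem decision_lost_prob_le (hh : 0 < h) (hq : q = (d : ℝ) / ((h : ℝ) + d)) (π : Params)
    (hk : 1 ≤ π.k) (hqβ : q < π.β) (hβ : π.β < 1 / 2) (hφ : 0 < phi π.β q π.k) {m : ℕ}
    (hm : m ≠ 0) (i : Bool) (x : Fin h → Bool) (y : Fin d → Bool)
    (ans : Queries h d → Fin d → Fin h → ℕ → Bool)
    (hx : NearConsensus ((π.β - q) / (2 * (1 - q))) i x) :
    (roundLaw π h d m).real {r | ¬ NearConsensus ((π.β - q) / (2 * (1 - q))) i
        (decision π.k x y (ans r.1) r)} ≤ Real.exp (-2 * h * phi π.β q π.k ^ 2) := by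
  have := isProbabilityMeasure_roundLaw (d := d) hh π m
  refine le_trans ?_ (nearConsensus_lost_prob_le hh hq π.k hqβ hφ i x y hx)
  rw [← roundLaw_real_fst hh π m, measureReal_def, measureReal_def]
  refine ENNReal.toReal_mono (measure_ne_top _ _) (measure_mono_ae ?_)
  filter_upwards [roundLaw_ae_threshold hh π hβ hm] with r hr hn
  exact not_nearConsensus_imp _ i _ _ r.1
    (fun j hj => mem_dissentSet_of_ne hk x y (ans r.1) r j π.β i hr hj) hn

/-- A round with a random threshold leads close to consensus with probability at least
`1 - failProb`. -/
theorem decision_fail_prob_le (hh : 0 < h) (hq : q = (d : ℝ) / ((h : ℝ) + d)) (π : Params)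
    (hk : 1 ≤ π.k) (hqβ : q < π.β) (hβ : π.β < 1 / 2)
    (hcontrol : controlLength π.β q π.k < 1 - 2 * π.β) {m : ℕ}
    (hm : m ≠ 0) (x : Fin h → Bool) (y : Fin d → Bool)
    (ans : Queries h d → Fin d → Fin h → ℕ → Bool) :
    (roundLaw π h d m).real {r | ∀ i, ¬ NearConsensus ((π.β - q) / (2 * (1 - q))) i
        (decision π.k x y (ans r.1) r)} ≤ failProb π.β q (h + d) π.k := by
  have := isProbabilityMeasure_roundLaw (d := d) hh π m
  have := isProbabilityMeasure_queryLaw (d := d) hh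
  have hq0 := q_nonneg hh hq
  set δ := margin π.β q π.k with hδ
  have hδ0 : 0 ≤ δ := margin_nonneg _ _ _
  set l := lowerRate x y - δ
  set u := upperRate x y + δ
  set e := Real.exp (-(1 / 8) * ((h : ℝ) + d) * ((π.β - q) ^ 2 / (4 * (1 - q)))) with he
  have hI : (thresholdLaw π m).real (Set.Icc l u)
      ≤ (q * (1 - π.β) + 2 * δ) / (1 - 2 * π.β) := by
    have hc := controlled_interval_le hh hq (q_bound_of_control hqβ hβ hcontrol) x y
    unfold thresholdLaw
    rw [if_neg hm]
    have := uniformLaw_real_Icc_le (x := π.β) (y := 1 - π.β) (by linarith) l u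
      (q * (1 - π.β) + 2 * δ)
      (add_nonneg (mul_nonneg hq0 (by linarith)) (by linarith)) (by
        have h1 : min u (1 - π.β) ≤ min (upperRate x y) (1 - π.β) + δ := by
          rw [← min_add_add_right]; exact min_le_min le_rfl (by linarith)
        have h2 : max (lowerRate x y) π.β - δ ≤ max l π.β := by
          rw [← max_sub_sub_right]; exact max_le_max le_rfl (by linarith)
        linarith)
    rwa [show 1 - π.β - π.β = 1 - 2 * π.β by ring] at this
  have hf := dissent_count_prob_le hh hq hk hqβ (by linarith) false x y u (by simp [u, hδ])
  have ht := dissent_count_prob_le hh hq hk hqβ (by linarith) true x y l (by simp [l, hδ])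
  rw [← roundLaw_real_fst hh π m] at hf ht
  rw [← roundLaw_real_snd (d := d) hh π m] at hI
  -- A threshold below `l` makes almost all nodes adopt `1`, one above `u` makes them adopt `0`.
  -- Failure needs a threshold in between or too many atypical rows.
  refine le_trans (measureReal_mono (?_ : _ ⊆ ({r : RoundData h d | r.2 ∈ Set.Icc l u} ∪
    ({r | r.1 ∈ {Q | (π.β - q) / (2 * (1 - q)) * h < (rowCount (dissentSet π.k false x y u) Q : ℝ)}} ∪
     {r | r.1 ∈ {Q | (π.β - q) / (2 * (1 - q)) * h < (rowCount (dissentSet π.k true x y l) Q : ℝ)}}))))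
    ?_
  · intro r hr
    by_cases h1 : r.2 < l
    · exact Or.inr (Or.inr (not_nearConsensus_imp _ true _ _ r.1 (fun j hj =>
        mem_dissentSet_true hk x y (ans r.1) r j l h1.le (by simpa using hj)) (hr true)))
    · by_cases h2 : u < r.2
      · exact Or.inr (Or.inl (not_nearConsensus_imp _ false _ _ r.1 (fun j hj =>
          mem_dissentSet_false hk x y (ans r.1) r j u h2.le (by simpa using hj)) (hr false)))
      · exact Or.inl ⟨not_lt.1 h1, not_lt.1 h2⟩
  · refine (measureReal_union_le _ _).trans ?_
    refine (add_le_add hI ((measureReal_union_le _ _).trans (add_le_add hf ht))).trans ?_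
    unfold failProb
    push_cast
    linarith

theorem lintegral_ofReal_le_of_ae_le {α : Type*} [MeasurableSpace α] {μ : Measure α}
    {V F : α → ℝ} {c : ℝ} (hF : Integrable F μ) (hF0 : 0 ≤ᵐ[μ] F) (hle : V ≤ᵐ[μ] F)
    (hc : ∫ a, F a ∂μ ≤ c) : ∫⁻ a, ENNReal.ofReal (V a) ∂μ ≤ ENNReal.ofReal c := by
  calc ∫⁻ a, ENNReal.ofReal (V a) ∂μ ≤ ∫⁻ a, ENNReal.ofReal (F a) ∂μ :=
        lintegral_mono_ae (hle.mono fun a ha => ENNReal.ofReal_le_ofReal ha)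
    _ = ENNReal.ofReal (∫ a, F a ∂μ) := (ofReal_integral_eq_lintegral_ofReal hF hF0).symm
    _ ≤ ENNReal.ofReal c := ENNReal.ofReal_le_ofReal hc

end FPC

/-! ### Resampling one round, and measurability of the dynamics -/

namespace FPC

open ProbabilityTheory

/-- Resampling one coordinate does not change a product measure. -/
theorem map_update_infinitePi {ι : Type*} [DecidableEq ι] {X : ι → Type*}
    [∀ i, MeasurableSpace (X i)] (μ : ∀ i, Measure (X i)) [∀ i, IsProbabilityMeasure (μ i)]
    (m : ι) :
    ((Measure.infinitePi μ).prod (μ m)).map (fun p => Function.update p.1 m p.2)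
      = Measure.infinitePi μ := by
  refine Measure.eq_infinitePi _ fun s t ht => ?_
  rw [Measure.map_apply measurable_update' (.pi (Finset.countable_toSet _) fun i _ => ht i)]
  have : (fun p : (∀ i, X i) × X m => Function.update p.1 m p.2) ⁻¹' Set.pi (↑s) t
      = Set.pi (↑(s.erase m)) t ×ˢ (if m ∈ s then t m else Set.univ) := by
    ext ⟨w, r⟩
    simp only [Set.mem_preimage, Set.mem_pi, Finset.mem_coe, Set.mem_prod, Finset.mem_erase]
    constructor
    · intro hw
      refine ⟨fun i hi => by simpa [hi.1] using hw i hi.2, ?_⟩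
      split_ifs with hm
      · simpa using hw m hm
      · trivial
    · rintro ⟨hw, hr⟩ i hi
      by_cases him : i = m
      · subst him
        simpa [hi] using hr
      · simpa [him] using hw i ⟨him, hi⟩
  rw [this, Measure.prod_prod, Measure.infinitePi_pi _ fun i _ => ht i]
  split_ifs with hm
  · exact Finset.prod_erase_mul s (fun i => μ i (t i)) hm
  · rw [Finset.erase_eq_of_notMem hm, measure_univ, mul_one]

variable {S : Type*} [MeasurableSpace S] {h d : ℕ}

/-- The sample point with the data of the round `m + 1` replaced by `r`. -/
def resample (ω : Sample S h d) (m : ℕ) (r : RoundData h d) : Sample S h d :=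
  (ω.1, Function.update ω.2 m r)

theorem measurable_resample (m : ℕ) :
    Measurable fun p : Sample S h d × RoundData h d => resample p.1 m p.2 := by
  refine (measurable_fst.comp measurable_fst).prodMk ?_
  exact measurable_update'.comp ((measurable_snd.comp measurable_fst).prodMk measurable_snd)

theorem isProbabilityMeasure_law (hh : 0 < h) (π : Params) (ν : Measure S)
    [IsProbabilityMeasure ν] : IsProbabilityMeasure (law π h d ν) := by
  have : ∀ m, IsProbabilityMeasure ((queryLaw h d).prod (thresholdLaw π m)) :=
    isProbabilityMeasure_roundLaw hh π
  unfold law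
  infer_instance

/-- Stands in for conditioning on the past: a bound for the inner integral at every fixed `ω` is a
one-step drift bound. -/
theorem lintegral_law_resample (hh : 0 < h) (π : Params) (ν : Measure S)
    [IsProbabilityMeasure ν] (m : ℕ) {f : Sample S h d → ENNReal} (hf : Measurable f) :
    ∫⁻ ω, f ω ∂(law π h d ν)
      = ∫⁻ ω, ∫⁻ r, f (resample ω m r) ∂(roundLaw π h d m) ∂(law π h d ν) := by
  have hp : ∀ m, IsProbabilityMeasure (roundLaw π h d m) := isProbabilityMeasure_roundLaw hh π
  have hlaw : law π h d ν = ν.prod (Measure.infinitePi (roundLaw π h d)) := rfl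
  have hfr : Measurable fun p : Sample S h d × RoundData h d => f (resample p.1 m p.2) :=
    hf.comp (measurable_resample m)
  rw [hlaw, lintegral_prod _ hf.aemeasurable, lintegral_prod _ hfr.lintegral_prod_right'.aemeasurable]
  refine lintegral_congr fun s => ?_
  have hfs : Measurable fun w : ℕ → RoundData h d => f (s, w) := hf.comp measurable_prodMk_left
  conv_lhs => rw [← map_update_infinitePi (roundLaw π h d) m]
  rw [lintegral_map hfs measurable_update', lintegral_prod]
  · rfl
  · exact (hfs.comp measurable_update').aemeasurable

theorem history_resample {S : Type*} (ω : Sample S h d) {m m' : ℕ} (hm : m' ≤ m) (r : RoundData h d) :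
    history (resample ω m r) m' = history ω m' := by
  unfold history resample
  refine Prod.ext rfl (funext fun i => ?_)
  exact Function.update_of_ne (by have := i.2; omega) _ _

variable (π : Params) (init : S → Fin h → Bool) (A : SemiCautiousAdversary S h d)

theorem state_succ (ω : Sample S h d) (m : ℕ) (j : Fin h) :
    state π init A ω (m + 1) j = (state π init A ω m j).update π (m + 1)
      (decision π.k (fun i => (state π init A ω m i).opinion) (A.opinion m (history ω m))
        (A.answers m (history ω m, (ω.2 m).1)) (ω.2 m) j) := rfl

/-- Non-anticipation: coordinate `m` belongs to round `m + 1`, so it does not affect the first `m`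
rounds. -/
theorem state_resample (ω : Sample S h d) {m m' : ℕ} (hm : m' ≤ m) (r : RoundData h d) :
    state π init A (resample ω m r) m' = state π init A ω m' := by
  induction m' with
  | zero => rfl
  | succ m' ih =>
    have h1 : (resample ω m r).2 m' = ω.2 m' := Function.update_of_ne (by omega) _ _
    funext j
    rw [state_succ, state_succ, ih (by omega), history_resample ω (by omega), h1]

theorem state_succ_resample (ω : Sample S h d) (m : ℕ) (r : RoundData h d) (j : Fin h) :
    state π init A (resample ω m r) (m + 1) j = (state π init A ω m j).update π (m + 1)
      (decision π.k (fun i => (state π init A ω m i).opinion) (A.opinion m (history ω m))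
        (A.answers m (history ω m, r.1)) r j) := by
  have h1 : (resample ω m r).2 m = r := Function.update_self _ _ _
  rw [state_succ, state_resample π init A ω le_rfl, history_resample ω le_rfl, h1]

instance instMeasurableSpaceNodeState : MeasurableSpace NodeState := ⊤

instance instDiscreteMeasurableSpaceNodeState : DiscreteMeasurableSpace NodeState :=
  ⟨fun _ => trivial⟩

instance instCountableNodeState : Countable NodeState := by
  refine Function.Injective.countable (f := fun s : NodeState => (s.opinion, s.run, s.final)) ?_
  rintro ⟨a, b, c⟩ ⟨a', b', c'⟩ hs
  simp only [Prod.mk.injEq] at hs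
  obtain ⟨rfl, rfl, rfl⟩ := hs
  rfl

theorem measurable_history (m : ℕ) : Measurable fun ω : Sample S h d => history ω m := by
  refine measurable_fst.prodMk (measurable_pi_iff.2 fun i => ?_)
  exact (measurable_pi_apply _).comp measurable_snd

theorem measurable_state (hinit : Measurable init) (m : ℕ) :
    Measurable fun ω => state π init A ω m := by
  induction m with
  | zero =>
    refine measurable_pi_iff.2 fun j => ?_
    exact (Measurable.of_discrete (f := fun b : Bool => NodeState.mk b 0 false)).comp
      ((measurable_pi_apply j).comp (hinit.comp measurable_fst))
  | succ m ih =>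
    refine measurable_pi_iff.2 fun j => ?_
    have hround : Measurable fun ω : Sample S h d => ω.2 m :=
      (measurable_pi_apply m).comp measurable_snd
    have hresp : Measurable fun ω : Sample S h d =>
        response (fun i => (state π init A ω m i).opinion) (A.opinion m (history ω m))
          (A.answers m (history ω m, (ω.2 m).1)) (ω.2 m).1 j := by
      refine measurable_pi_iff.2 fun t => ?_
      -- All arguments range over countable discrete types, so a response is automatically a
      -- measurable function of them.
      set F : Node h d × (Fin h → NodeState) × (Fin d → Bool) × (Fin d → Bool) → Option Bool :=
        fun p => match p.1 with
          | Sum.inl i => some (p.2.1 i).opinion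
          | Sum.inr i => if p.2.2.2 i then some (p.2.2.1 i) else none
      have hF : Measurable F := Measurable.of_discrete
      refine hF.comp (Measurable.prodMk ?_ (ih.prodMk (Measurable.prodMk ?_ ?_)))
      · exact (measurable_pi_apply t).comp ((measurable_pi_apply j).comp
          (measurable_fst.comp hround))
      · exact (A.measurable_opinion m).comp (measurable_history m)
      · have h1 := (A.measurable_answers m).comp
          ((measurable_history (S := S) (h := h) (d := d) m).prodMk (measurable_fst.comp hround))
        exact measurable_pi_iff.2 fun i => (measurable_pi_apply t).comp
          ((measurable_pi_apply j).comp ((measurable_pi_apply i).comp h1))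
    have hdec : Measurable fun ω : Sample S h d =>
        decision π.k (fun i => (state π init A ω m i).opinion) (A.opinion m (history ω m))
          (A.answers m (history ω m, (ω.2 m).1)) (ω.2 m) j := by
      classical
      have hset : MeasurableSet {ω : Sample S h d | (ω.2 m).2 ≤
          (onesAmongFirst π.k (response (fun i => (state π init A ω m i).opinion)
            (A.opinion m (history ω m)) (A.answers m (history ω m, (ω.2 m).1)) (ω.2 m).1 j) : ℝ)
            / (π.k : ℝ)} :=
        measurableSet_le (measurable_snd.comp hround)
          (((measurable_ones_cast π.k).comp hresp).div_const _)
      refine measurable_to_bool ?_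
      convert hset using 1
      ext ω
      exact decide_eq_true_iff
    exact (Measurable.of_discrete (f := fun p : NodeState × Bool => p.1.update π (m + 1) p.2)).comp
      (((measurable_pi_apply j).comp ih).prodMk hdec)

end FPC

/-! ### Runs of successes and failures, and the potential of a single node -/

namespace FPC

open ProbabilityTheory

/-- The probability that independent trials with failure probability `p` do not produce a run of
`ℓ` successes within `T` steps, when the current run of successes has length `r`. -/
noncomputable def noRunProb (ℓ : ℕ) (p : ℝ) : ℕ → ℕ → ℝ
  | 0, r => if ℓ ≤ r then 0 else 1
  | T + 1, r => if ℓ ≤ r then 0 else p * noRunProb ℓ p T 0 + (1 - p) * noRunProb ℓ p T (r + 1)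

section NoRun

variable {ℓ : ℕ} {p : ℝ}

theorem noRunProb_of_le (T : ℕ) {r : ℕ} (h : ℓ ≤ r) : noRunProb ℓ p T r = 0 := by
  cases T <;> simp [noRunProb, h]

theorem noRunProb_zero_of_lt {r : ℕ} (h : r < ℓ) : noRunProb ℓ p 0 r = 1 := by
  simp [noRunProb, h]

theorem noRunProb_succ_of_lt (T : ℕ) {r : ℕ} (h : r < ℓ) : noRunProb ℓ p (T + 1) r
    = p * noRunProb ℓ p T 0 + (1 - p) * noRunProb ℓ p T (r + 1) := by
  rw [noRunProb, if_neg (not_le.2 h)]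

theorem noRunProb_mem_Icc (h0 : 0 ≤ p) (h1 : p ≤ 1) (T r : ℕ) :
    noRunProb ℓ p T r ∈ Set.Icc (0 : ℝ) 1 := by
  induction T generalizing r with
  | zero => unfold noRunProb; split_ifs <;> simp
  | succ T ih =>
    unfold noRunProb
    split_ifs
    · simp
    · have a := ih 0
      have b := ih (r + 1)
      constructor
      · exact add_nonneg (mul_nonneg h0 a.1) (mul_nonneg (sub_nonneg.2 h1) b.1)
      · nlinarith [a.2, b.2, mul_le_mul_of_nonneg_left b.2 (sub_nonneg.2 h1)]

theorem noRunProb_anti_run (h0 : 0 ≤ p) (h1 : p ≤ 1) (T : ℕ) {r r' : ℕ} (h : r' ≤ r) :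
    noRunProb ℓ p T r ≤ noRunProb ℓ p T r' := by
  by_cases hr : ℓ ≤ r
  · rw [noRunProb_of_le T hr]; exact (noRunProb_mem_Icc h0 h1 T r').1
  · induction T generalizing r r' with
    | zero => rw [noRunProb_zero_of_lt (by omega), noRunProb_zero_of_lt (by omega)]
    | succ T ih =>
      rw [noRunProb_succ_of_lt T (by omega), noRunProb_succ_of_lt T (by omega)]
      have : noRunProb ℓ p T (r + 1) ≤ noRunProb ℓ p T (r' + 1) := by
        by_cases hr1 : ℓ ≤ r + 1
        · rw [noRunProb_of_le T hr1]; exact (noRunProb_mem_Icc h0 h1 T _).1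
        · exact ih (by omega) hr1
      have := mul_le_mul_of_nonneg_left this (sub_nonneg.2 h1)
      linarith

theorem noRunProb_succ_le (h0 : 0 ≤ p) (h1 : p ≤ 1) (T r : ℕ) :
    noRunProb ℓ p (T + 1) r ≤ noRunProb ℓ p T r := by
  by_cases hr : ℓ ≤ r
  · rw [noRunProb_of_le _ hr, noRunProb_of_le _ hr]
  · rw [not_le] at hr
    induction T generalizing r with
    | zero =>
      rw [noRunProb_zero_of_lt hr]; exact (noRunProb_mem_Icc h0 h1 _ r).2
    | succ T ih =>
      rw [noRunProb_succ_of_lt _ hr, noRunProb_succ_of_lt _ hr]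
      have a := ih 0 (by omega)
      have b : noRunProb ℓ p (T + 1) (r + 1) ≤ noRunProb ℓ p T (r + 1) := by
        by_cases hr1 : ℓ ≤ r + 1
        · rw [noRunProb_of_le _ hr1, noRunProb_of_le _ hr1]
        · exact ih _ (by omega)
      exact add_le_add (mul_le_mul_of_nonneg_left a h0)
        (mul_le_mul_of_nonneg_left b (sub_nonneg.2 h1))

/-- With probability (1-p)^τ the first τ trials succeed and complete the run. Otherwise a failure
resets it to 0 with at least `T` trials left, and more trials only help. -/
theorem noRunProb_add_le (h0 : 0 ≤ p) (h1 : p ≤ 1) (T τ r : ℕ) (h : ℓ ≤ r + τ) :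
    noRunProb ℓ p (T + τ) r ≤ (1 - (1 - p) ^ τ) * noRunProb ℓ p T 0 := by
  have hN := noRunProb_mem_Icc (ℓ := ℓ) h0 h1 T 0
  have hpow : ∀ t, 0 ≤ 1 - (1 - p) ^ t := fun t =>
    sub_nonneg.2 (pow_le_one₀ (sub_nonneg.2 h1) (by linarith))
  by_cases hr : ℓ ≤ r
  · rw [noRunProb_of_le _ hr]; exact mul_nonneg (hpow τ) hN.1
  · rw [not_le] at hr
    induction τ generalizing r with
    | zero => omega
    | succ τ ih =>
      rw [← add_assoc, noRunProb_succ_of_lt _ hr]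
      have a : noRunProb ℓ p (T + τ) 0 ≤ noRunProb ℓ p T 0 :=
        antitone_nat_of_succ_le (f := fun t => noRunProb ℓ p t 0)
          (fun t => noRunProb_succ_le h0 h1 t 0) (Nat.le_add_right T τ)
      have b : noRunProb ℓ p (T + τ) (r + 1) ≤ (1 - (1 - p) ^ τ) * noRunProb ℓ p T 0 := by
        by_cases hr1 : ℓ ≤ r + 1
        · rw [noRunProb_of_le _ hr1]; exact mul_nonneg (hpow τ) hN.1
        · exact ih _ (by omega) (by omega)
      have a' := mul_le_mul_of_nonneg_left a h0
      have b' := mul_le_mul_of_nonneg_left b (sub_nonneg.2 h1)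
      rw [pow_succ]
      linarith

theorem noRunProb_mul_le (h0 : 0 ≤ p) (h1 : p ≤ 1) (u : ℕ) :
    noRunProb ℓ p (ℓ * u) 0 ≤ (1 - (1 - p) ^ ℓ) ^ u := by
  induction u with
  | zero => simpa using (noRunProb_mem_Icc (ℓ := ℓ) h0 h1 0 0).2
  | succ u ih =>
    rw [Nat.mul_succ, pow_succ, mul_comm ((1 - (1 - p) ^ ℓ) ^ u)]
    exact (noRunProb_add_le h0 h1 (ℓ * u) ℓ 0 (by omega)).trans
      (mul_le_mul_of_nonneg_left ih (sub_nonneg.2 (pow_le_one₀ (sub_nonneg.2 h1) (by linarith))))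

end NoRun

/-- The probability that, after a first failure, a run of `ℓ` failures precedes the first run of
`ℓ` successes. -/
noncomputable def ruinProb (ℓ : ℕ) (p : ℝ) : ℝ :=
  p ^ (ℓ - 1) / (p ^ (ℓ - 1) + (1 - p) ^ (ℓ - 1) - p ^ (ℓ - 1) * (1 - p) ^ (ℓ - 1))

/-- The probability that a run of `ℓ` failures precedes the first run of `ℓ` successes, when the
current run consists of `r` successes (`b = true`) or of `r` failures (`b = false`). -/
noncomputable def ruinProbFrom (ℓ : ℕ) (p : ℝ) (b : Bool) (r : ℕ) : ℝ :=
  if b then (1 - (1 - p) ^ (ℓ - r)) * ruinProb ℓ p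
  else p ^ (ℓ - r) + (1 - p ^ (ℓ - r)) * ((1 - (1 - p) ^ (ℓ - 1)) * ruinProb ℓ p)

section Ruin

variable {ℓ : ℕ} {p : ℝ}

theorem ruin_denominator_ge (h0 : 0 < p) (h1 : p < 1) :
    (1 - p) ^ (ℓ - 1) ≤ p ^ (ℓ - 1) + (1 - p) ^ (ℓ - 1) - p ^ (ℓ - 1) * (1 - p) ^ (ℓ - 1) := by
  have a : 0 < p ^ (ℓ - 1) := pow_pos h0 _
  have b : (1 - p) ^ (ℓ - 1) ≤ 1 := pow_le_one₀ (by linarith) (by linarith)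
  nlinarith

theorem ruin_denominator_pos (h0 : 0 < p) (h1 : p < 1) :
    0 < p ^ (ℓ - 1) + (1 - p) ^ (ℓ - 1) - p ^ (ℓ - 1) * (1 - p) ^ (ℓ - 1) :=
  lt_of_lt_of_le (pow_pos (by linarith) _) (ruin_denominator_ge h0 h1)

theorem ruinProb_nonneg (h0 : 0 < p) (h1 : p < 1) : 0 ≤ ruinProb ℓ p :=
  div_nonneg (pow_nonneg h0.le _) (ruin_denominator_pos h0 h1).le

theorem ruinProb_le_one (h0 : 0 < p) (h1 : p < 1) : ruinProb ℓ p ≤ 1 := by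
  refine div_le_one_of_le₀ ?_ (ruin_denominator_pos h0 h1).le
  have a : p ^ (ℓ - 1) ≤ 1 := pow_le_one₀ h0.le h1.le
  have b : 0 ≤ (1 - p) ^ (ℓ - 1) := pow_nonneg (by linarith) _
  nlinarith

theorem ruinProb_le (h0 : 0 < p) (h1 : p < 1) : ruinProb ℓ p ≤ (p / (1 - p)) ^ (ℓ - 1) := by
  rw [div_pow]
  exact div_le_div_of_nonneg_left (pow_nonneg h0.le _) (pow_pos (by linarith) _)
    (ruin_denominator_ge h0 h1)

/-- After a first failure, either the next ℓ-1 trials fail too, or a success intervenes. In the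
latter case ruin requires a failure among the ℓ-1 trials after it, which restores the initial
situation. -/
theorem ruinProb_eq (h0 : 0 < p) (h1 : p < 1) :
    p ^ (ℓ - 1) + (1 - p ^ (ℓ - 1)) * ((1 - (1 - p) ^ (ℓ - 1)) * ruinProb ℓ p) = ruinProb ℓ p := by
  have h := (ruin_denominator_pos (ℓ := ℓ) h0 h1).ne'
  have : ruinProb ℓ p * (p ^ (ℓ - 1) + (1 - p) ^ (ℓ - 1) - p ^ (ℓ - 1) * (1 - p) ^ (ℓ - 1))
      = p ^ (ℓ - 1) := div_mul_cancel₀ _ h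
  linear_combination -this

theorem one_sub_pow_mem (h0 : 0 < p) (h1 : p < 1) (m : ℕ) :
    1 - (1 - p) ^ m ∈ Set.Icc (0 : ℝ) 1 :=
  ⟨sub_nonneg.2 (pow_le_one₀ (by linarith) (by linarith)),
    sub_le_self _ (pow_nonneg (by linarith) _)⟩

theorem ruinProbFrom_nonneg (h0 : 0 < p) (h1 : p < 1) (b : Bool) (r : ℕ) :
    0 ≤ ruinProbFrom ℓ p b r := by
  have hr := ruinProb_nonneg (ℓ := ℓ) h0 h1
  unfold ruinProbFrom
  split_ifs
  · exact mul_nonneg (one_sub_pow_mem h0 h1 _).1 hr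
  · exact add_nonneg (pow_nonneg h0.le _) (mul_nonneg
      (sub_nonneg.2 (pow_le_one₀ h0.le h1.le)) (mul_nonneg (one_sub_pow_mem h0 h1 _).1 hr))

theorem ruinProbFrom_true_le (h0 : 0 < p) (h1 : p < 1) (r : ℕ) :
    ruinProbFrom ℓ p true r ≤ ruinProb ℓ p := by
  have hr := ruinProb_nonneg (ℓ := ℓ) h0 h1
  simp only [ruinProbFrom, if_true]
  exact mul_le_of_le_one_left hr (one_sub_pow_mem h0 h1 _).2

theorem ruinProbFrom_false_one (h0 : 0 < p) (h1 : p < 1) :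
    ruinProbFrom ℓ p false 1 = ruinProb ℓ p := by
  simpa [ruinProbFrom] using ruinProb_eq h0 h1

/-- The right side is a convex combination of 1 and the left side. -/
theorem ruinProbFrom_true_one_le (h0 : 0 < p) (h1 : p < 1) (r : ℕ) :
    ruinProbFrom ℓ p true 1 ≤ ruinProbFrom ℓ p false r := by
  have hr := ruinProb_nonneg (ℓ := ℓ) h0 h1
  have hr1 := ruinProb_le_one (ℓ := ℓ) h0 h1
  have hm := one_sub_pow_mem h0 h1 (ℓ - 1)
  have hc : (1 - (1 - p) ^ (ℓ - 1)) * ruinProb ℓ p ≤ 1 := mul_le_one₀ hm.2 hr hr1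
  have hf : 0 ≤ p ^ (ℓ - r) := pow_nonneg h0.le _
  simp only [ruinProbFrom, if_true, Bool.false_eq_true, if_false]
  nlinarith

theorem ruinProbFrom_zero_le (h0 : 0 < p) (h1 : p < 1) (b : Bool) :
    ruinProbFrom ℓ p b 0 ≤ ruinProb ℓ p := by
  cases b
  · have hr := ruinProb_nonneg (ℓ := ℓ) h0 h1
    have hr1 := ruinProb_le_one (ℓ := ℓ) h0 h1
    have hm := one_sub_pow_mem h0 h1 (ℓ - 1)
    have hc : (1 - (1 - p) ^ (ℓ - 1)) * ruinProb ℓ p ≤ 1 := mul_le_one₀ hm.2 hr hr1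
    have hf : p ^ ℓ ≤ p ^ (ℓ - 1) := pow_le_pow_of_le_one h0.le h1.le (Nat.sub_le _ _)
    conv_rhs => rw [← ruinProb_eq h0 h1]
    simp only [ruinProbFrom, Bool.false_eq_true, if_false, Nat.sub_zero]
    nlinarith
  · exact ruinProbFrom_true_le h0 h1 0

/-- First-step equation: a failure starts a failure run of length 1. Together with
`ruinProbFrom_false_step` it makes the ruin part of the potential harmonic. -/
theorem ruinProbFrom_true_step (h0 : 0 < p) (h1 : p < 1) {r : ℕ} (hr : r < ℓ) :
    p * ruinProbFrom ℓ p false 1 + (1 - p) * ruinProbFrom ℓ p true (r + 1)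
      = ruinProbFrom ℓ p true r := by
  rw [ruinProbFrom_false_one h0 h1]
  simp only [ruinProbFrom, if_true]
  rw [show ℓ - r = (ℓ - (r + 1)) + 1 by omega, pow_succ]
  ring

theorem ruinProbFrom_false_step {r : ℕ} (hr : r < ℓ) :
    p * ruinProbFrom ℓ p false (r + 1) + (1 - p) * ruinProbFrom ℓ p true 1
      = ruinProbFrom ℓ p false r := by
  simp only [ruinProbFrom, if_true, Bool.false_eq_true, if_false]
  rw [show ℓ - r = (ℓ - (r + 1)) + 1 by omega, pow_succ]
  ring

end Ruin

/-- A bound for the probability that a node in the state `s` does not have the final opinion `i`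
after `T` more rounds, if it disagrees with `i` with probability at most `p` in each round. -/
noncomputable def nodePotential (ℓ : ℕ) (p : ℝ) (T : ℕ) (i : Bool) (s : NodeState) : ℝ :=
  noRunProb ℓ p T (if s.opinion = i then s.run else 0)
    + ruinProbFrom ℓ p (decide (s.opinion = i)) s.run

section NodePotential

variable {ℓ : ℕ} {p : ℝ}

theorem nodePotential_nonneg (h0 : 0 < p) (h1 : p < 1) (T : ℕ) (i : Bool) (s : NodeState) :
    0 ≤ nodePotential ℓ p T i s :=
  add_nonneg (noRunProb_mem_Icc h0.le h1.le _ _).1 (ruinProbFrom_nonneg h0 h1 _ _)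

theorem nodePotential_start_le (h0 : 0 < p) (h1 : p < 1) (u : ℕ) (i : Bool) (s : NodeState)
    (hs : s.run = 0) : nodePotential ℓ p (ℓ * u) i s
      ≤ (1 - (1 - p) ^ ℓ) ^ u + (p / (1 - p)) ^ (ℓ - 1) := by
  unfold nodePotential
  rw [hs, ite_self]
  exact add_le_add (noRunProb_mul_le h0.le h1.le u)
    ((ruinProbFrom_zero_le h0 h1 _).trans (ruinProb_le h0 h1))

theorem one_le_nodePotential_of_wrong (h0 : 0 < p) (h1 : p < 1) (T : ℕ) (i : Bool) (s : NodeState)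
    (hs : ℓ ≤ s.run) (hi : s.opinion ≠ i) : 1 ≤ nodePotential ℓ p T i s := by
  have := (noRunProb_mem_Icc (ℓ := ℓ) h0.le h1.le T 0).1
  simp only [nodePotential, hi, if_false, ruinProbFrom, decide_false, Bool.false_eq_true,
    Nat.sub_eq_zero_of_le hs, pow_zero, sub_self, zero_mul, add_zero]
  linarith

theorem one_le_nodePotential_zero (hℓ : 1 ≤ ℓ) (h0 : 0 < p) (h1 : p < 1) (i : Bool)
    (s : NodeState) (hs : s.opinion = i → s.run < ℓ) : 1 ≤ nodePotential ℓ p 0 i s := by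
  have := ruinProbFrom_nonneg (ℓ := ℓ) h0 h1 (decide (s.opinion = i)) s.run
  unfold nodePotential
  rw [noRunProb_zero_of_lt (by split_ifs with hi; exacts [hs hi, hℓ])]
  linarith

/-- The consistency of the flag and the run length in the state of a node. -/
def NodeState.Consistent (ℓ : ℕ) (s : NodeState) : Prop := s.final = true ↔ ℓ ≤ s.run

theorem NodeState.Consistent.update {π : Params} {s : NodeState} (hs : s.Consistent π.ℓ) (r : ℕ)
    (b : Bool) : (s.update π r b).Consistent π.ℓ := by
  unfold NodeState.update
  split_ifs with h1
  · exact hs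
  all_goals simp [NodeState.Consistent]

/-- `g0` and `g1` bound the next potential after agreement and disagreement with `i`. Since `g0 ≤
g1`, an upper bound `p` for the probability of disagreement suffices, and its exact value,
controlled by the adversary, does not matter. -/
theorem nodePotential_step {π : Params} (hℓ : 1 ≤ π.ℓ) (h0 : 0 < p) (h1 : p < 1) (T : ℕ)
    (i : Bool) (s : NodeState) (hs : s.Consistent π.ℓ) {m : ℕ} (hm : π.m₀ < m)
    (hi : s.final = true → s.opinion = i) :
    ∃ g0 g1 : ℝ, 0 ≤ g0 ∧ g0 ≤ g1 ∧ g0 + p * (g1 - g0) ≤ nodePotential π.ℓ p (T + 1) i s ∧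
      ∀ b, nodePotential π.ℓ p T i (s.update π m b) ≤ if b = i then g0 else g1 := by
  by_cases hfin : s.final = true
  · refine ⟨0, 0, le_rfl, le_rfl, by simpa using nodePotential_nonneg h0 h1 _ _ _, fun b => ?_⟩
    have hu : s.update π m b = s := by simp [NodeState.update, hfin]
    rw [hu, ite_self]
    have hr := hs.1 hfin
    simp [nodePotential, hi hfin, noRunProb_of_le T hr, ruinProbFrom, Nat.sub_eq_zero_of_le hr]
  · have hr : s.run < π.ℓ := by
      by_contra h
      exact hfin (hs.2 (not_lt.1 h))
    have hu : ∀ b, s.update π m b = ⟨b, if b = s.opinion then s.run + 1 else 1,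
        decide (π.ℓ ≤ if b = s.opinion then s.run + 1 else 1)⟩ := by
      intro b
      simp [NodeState.update, hfin, not_le.2 hm]
    by_cases ho : s.opinion = i
    · refine ⟨noRunProb π.ℓ p T (s.run + 1) + ruinProbFrom π.ℓ p true (s.run + 1),
        noRunProb π.ℓ p T 0 + ruinProbFrom π.ℓ p false 1, ?_, ?_, ?_, ?_⟩
      · exact add_nonneg (noRunProb_mem_Icc h0.le h1.le _ _).1 (ruinProbFrom_nonneg h0 h1 _ _)
      · refine add_le_add (noRunProb_anti_run h0.le h1.le T (Nat.zero_le _)) ?_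
        rw [ruinProbFrom_false_one h0 h1]
        exact ruinProbFrom_true_le h0 h1 _
      · simp only [nodePotential, ho, if_true, decide_true]
        rw [noRunProb_succ_of_lt T hr, ← ruinProbFrom_true_step h0 h1 hr]
        linarith
      · intro b
        rw [hu]
        by_cases hb : b = i
        · simp [nodePotential, hb, ho]
        · simp [nodePotential, hb, ho]
    · refine ⟨noRunProb π.ℓ p T 1 + ruinProbFrom π.ℓ p true 1,
        noRunProb π.ℓ p T 0 + ruinProbFrom π.ℓ p false (s.run + 1), ?_, ?_, ?_, ?_⟩
      · exact add_nonneg (noRunProb_mem_Icc h0.le h1.le _ _).1 (ruinProbFrom_nonneg h0 h1 _ _)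
      · exact add_le_add (noRunProb_anti_run h0.le h1.le T (Nat.zero_le _))
          (ruinProbFrom_true_one_le h0 h1 _)
      · simp only [nodePotential, ho, if_false, decide_false]
        rw [noRunProb_succ_of_lt T (Nat.lt_of_lt_of_le Nat.zero_lt_one hℓ), zero_add,
          ← ruinProbFrom_false_step hr]
        linarith
      · intro b
        rw [hu]
        by_cases hb : b = i
        · have : i ≠ s.opinion := fun h => ho h.symm
          simp [nodePotential, hb, this]
        · have : b = s.opinion := by
            cases b <;> cases i <;> cases h : s.opinion <;> simp_all
          simp [nodePotential, hb, ← this]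

end NodePotential

end FPC

/-! ### Supermartingale potentials for the whole network -/

namespace FPC

open ProbabilityTheory

variable {h d : ℕ} {q : ℝ}

/-- The opinions of the honest nodes in given states. -/
def opinions (s : Fin h → NodeState) (j : Fin h) : Bool := (s j).opinion

open Classical in
/-- A bound for the probability that `T` rounds after the cooling-off period the honest nodes do
not all have the final opinion `i`; here `e` bounds the probability that closeness to consensus
gets lost in a round. -/
noncomputable def consensusPotential (ℓ : ℕ) (θ p e : ℝ) (T : ℕ) (i : Bool)
    (s : Fin h → NodeState) : ℝ :=
  if NearConsensus θ i (opinions s) then min 1 (T * e + ∑ j, nodePotential ℓ p T i (s j)) else 1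

theorem consensusPotential_le_one (ℓ : ℕ) (θ p e : ℝ) (T : ℕ) (i : Bool)
    (s : Fin h → NodeState) : consensusPotential ℓ θ p e T i s ≤ 1 := by
  unfold consensusPotential
  split_ifs
  exacts [min_le_left _ _, le_rfl]

theorem opinion_update_ne {π : Params} {s : NodeState} {m : ℕ} {b i : Bool}
    (hi : s.final = true → s.opinion = i) (h : (s.update π m b).opinion ≠ i) : b ≠ i := by
  unfold NodeState.update at h
  split_ifs at h with hf
  · exact absurd (hi hf) h
  all_goals exact h

theorem errProb_pos (β q : ℝ) (k : ℕ) : 0 < errProb β q k := Real.exp_pos _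

theorem errProb_lt_one {β q : ℝ} {k : ℕ} (hk : 1 ≤ k) (hqβ : q < β) : errProb β q k < 1 := by
  have hk' : (0 : ℝ) < k := by exact_mod_cast hk
  have : 0 < (β - q) ^ 2 := pow_pos (by linarith) 2
  unfold errProb
  rw [Real.exp_lt_one_iff]
  have : 0 < (k : ℝ) * (β - q) ^ 2 := by positivity
  linarith

/-- Where the potential is 1 there is nothing to prove. Elsewhere near consensus holds; losing it
costs `e`, and otherwise the node potentials are added by linearity, so this sum uses only the law
of single rows. -/
theorem consensusPotential_step (hh : 0 < h) (hq : q = (d : ℝ) / ((h : ℝ) + d)) (π : Params)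
    (hk : 1 ≤ π.k) (hℓ : 1 ≤ π.ℓ) (hqβ : q < π.β) (hβ : π.β < 1 / 2) (hφ : 0 < phi π.β q π.k)
    {m : ℕ} (hm : m ≠ 0) (hm₀ : π.m₀ ≤ m) (T : ℕ) (i : Bool) (s : Fin h → NodeState)
    (hs : ∀ j, (s j).Consistent π.ℓ) (y : Fin d → Bool)
    (ans : Queries h d → Fin d → Fin h → ℕ → Bool) :
    ∫⁻ r, ENNReal.ofReal (consensusPotential π.ℓ ((π.β - q) / (2 * (1 - q))) (errProb π.β q π.k)
        (Real.exp (-2 * h * phi π.β q π.k ^ 2)) T i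
        (fun j => (s j).update π (m + 1) (decision π.k (opinions s) y (ans r.1) r j)))
        ∂(roundLaw π h d m)
      ≤ ENNReal.ofReal (consensusPotential π.ℓ ((π.β - q) / (2 * (1 - q))) (errProb π.β q π.k)
        (Real.exp (-2 * h * phi π.β q π.k ^ 2)) (T + 1) i s) := by
  classical
  have := isProbabilityMeasure_roundLaw (d := d) hh π m
  set θ := (π.β - q) / (2 * (1 - q)) with hθ
  set p := errProb π.β q π.k with hp
  set e := Real.exp (-2 * h * phi π.β q π.k ^ 2) with he
  have hp0 : 0 < p := errProb_pos _ _ _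
  have hp1 : p < 1 := errProb_lt_one hk hqβ
  have he0 : 0 ≤ e := (Real.exp_pos _).le
  rcases le_or_gt 1 (consensusPotential π.ℓ θ p e (T + 1) i s) with hbig | hsmall
  · calc _ ≤ ∫⁻ _r, 1 ∂(roundLaw π h d m) := lintegral_mono fun r =>
          ENNReal.ofReal_le_one.2 (consensusPotential_le_one _ _ _ _ _ _ _)
      _ = 1 := by simp
      _ ≤ _ := ENNReal.one_le_ofReal.2 hbig
  have hnc : NearConsensus θ i (opinions s) := by
    by_contra hn
    simp [consensusPotential, hn] at hsmall
  have hpot : consensusPotential π.ℓ θ p e (T + 1) i s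
      = ((T + 1 : ℕ) : ℝ) * e + ∑ j, nodePotential π.ℓ p (T + 1) i (s j) := by
    rw [consensusPotential, if_pos hnc] at hsmall ⊢
    exact min_eq_right ((min_lt_iff.1 hsmall).resolve_left (lt_irrefl _)).le
  -- A node with the wrong final opinion contributes at least 1 by itself, contrary to `hsmall`.
  have hwrong : ∀ j, (s j).final = true → (s j).opinion = i := by
    intro j hj
    by_contra hne
    have h1 := one_le_nodePotential_of_wrong (ℓ := π.ℓ) hp0 hp1 (T + 1) i (s j) ((hs j).1 hj) hne
    have h2 := Finset.single_le_sum (f := fun j => nodePotential π.ℓ p (T + 1) i (s j))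
      (fun j _ => nodePotential_nonneg hp0 hp1 (T + 1) i (s j)) (Finset.mem_univ j)
    have h3 : 0 ≤ ((T + 1 : ℕ) : ℝ) * e := by positivity
    linarith
  choose g0 g1 hg0 hg1 hg hstep using fun j =>
    nodePotential_step hℓ hp0 hp1 T i (s j) (hs j) (Nat.lt_succ_of_le hm₀) (hwrong j)
  set E := dissentSet π.k i (opinions s) y (extremeThreshold π.β i) with hE
  have hEm : MeasurableSet E := measurableSet_dissentSet _ _ _ _ _
  have hEp : (rowLaw h d).real E ≤ p := dissent_prob_le hh hq π.k hqβ i (opinions s) y hnc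
  set B : Set (RoundData h d) := {r | r.1 ∈ {Q : Queries h d | θ * h < (rowCount E Q : ℝ)}} with hB
  have hBm : MeasurableSet B :=
    (measurableSet_lt measurable_const ((Measurable.of_discrete (f := fun n : ℕ => (n : ℝ))).comp
      (measurable_rowCount hEm))).preimage measurable_fst
  have hBp : (roundLaw π h d m).real B ≤ e := by
    rw [hB, roundLaw_real_fst hh]
    exact nearConsensus_lost_prob_le hh hq π.k hqβ hφ i (opinions s) y hnc
  set D : Fin h → Set (RoundData h d) := fun j => {r | r.1 j ∈ E} with hD
  have hDm : ∀ j, MeasurableSet (D j) := fun j =>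
    hEm.preimage ((measurable_pi_apply j).comp measurable_fst)
  -- An integrable majorant of the next potential: the full cost 1 on the event `B` of too many
  -- dissenting rows, plus the node bounds with disagreement replaced by membership in `D j`.
  set F : RoundData h d → ℝ := fun r => B.indicator 1 r + (T * e
    + ∑ j, (g0 j + (g1 j - g0 j) * (D j).indicator 1 r)) with hF
  have hDi : ∀ j, Integrable ((D j).indicator (1 : RoundData h d → ℝ)) (roundLaw π h d m) :=
    fun j => (integrable_const (1 : ℝ)).indicator (hDm j)
  have hind : ∀ j, Integrable (fun r => g0 j + (g1 j - g0 j) *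
      (D j).indicator (1 : RoundData h d → ℝ) r)
      (roundLaw π h d m) := fun j =>
    (integrable_const _).add ((hDi j).const_mul _)
  have hBi : Integrable (B.indicator (1 : RoundData h d → ℝ)) (roundLaw π h d m) :=
    (integrable_const (1 : ℝ)).indicator hBm
  have hsumi := integrable_finsetSum Finset.univ fun j _ => hind j
  have hresti : Integrable (fun r => T * e + ∑ j, (g0 j + (g1 j - g0 j) *
      (D j).indicator (1 : RoundData h d → ℝ) r)) (roundLaw π h d m) :=
    (integrable_const _).add hsumi
  have hnode : ∀ (r : RoundData h d) (j : Fin h), 0 ≤ g0 j + (g1 j - g0 j) *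
      (D j).indicator (1 : RoundData h d → ℝ) r := fun r j =>
    add_nonneg (hg0 j) (mul_nonneg (sub_nonneg.2 (hg1 j))
      (Set.indicator_nonneg (fun _ _ => zero_le_one) _))
  have hrest : ∀ r : RoundData h d, 0 ≤ T * e + ∑ j, (g0 j + (g1 j - g0 j) *
      (D j).indicator (1 : RoundData h d → ℝ) r) := fun r =>
    add_nonneg (by positivity) (Finset.sum_nonneg fun j _ => hnode r j)
  refine lintegral_ofReal_le_of_ae_le (F := F) (hBi.add hresti)
    (Filter.Eventually.of_forall fun r =>
      add_nonneg (Set.indicator_nonneg (fun _ _ => zero_le_one) _) (hrest r)) ?_ ?_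
  · filter_upwards [roundLaw_ae_threshold hh π hβ hm] with r hr
    have hmem : ∀ j, decision π.k (opinions s) y (ans r.1) r j ≠ i → r.1 j ∈ E := fun j hj =>
      mem_dissentSet_of_ne hk (opinions s) y (ans r.1) r j π.β i hr hj
    by_cases hrB : r ∈ B
    · refine (consensusPotential_le_one _ _ _ _ _ _ _).trans ?_
      simp only [hF, Set.indicator_of_mem hrB, Pi.one_apply]
      linarith [hrest r]
    · have hnc' : NearConsensus θ i (opinions fun j =>
          (s j).update π (m + 1) (decision π.k (opinions s) y (ans r.1) r j)) := by
        by_contra hn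
        exact hrB (not_nearConsensus_imp θ i _ E r.1
          (fun j hj => hmem j (opinion_update_ne (hwrong j) hj)) hn)
      rw [consensusPotential, if_pos hnc']
      refine (min_le_right _ _).trans ?_
      simp only [hF, Set.indicator_of_notMem hrB, zero_add]
      refine add_le_add le_rfl (Finset.sum_le_sum fun j _ => (hstep j _).trans ?_)
      split_ifs with hd
      · exact le_add_of_nonneg_right (mul_nonneg (sub_nonneg.2 (hg1 j))
          (Set.indicator_nonneg (fun _ _ => zero_le_one) _))
      · rw [Set.indicator_of_mem (show r ∈ D j from hmem j hd)]
        simp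
  · have hI : ∀ j, ∫ r, (g0 j + (g1 j - g0 j) *
        (D j).indicator (1 : RoundData h d → ℝ) r) ∂(roundLaw π h d m)
        = g0 j + (g1 j - g0 j) * (rowLaw h d).real E := by
      intro j
      rw [integral_add (integrable_const _) ((hDi j).const_mul _), integral_const_mul,
        integral_indicator_one (hDm j), hD, roundLaw_real_row hh π m j hEm]
      simp
    have hInt : ∫ r, F r ∂(roundLaw π h d m) = (roundLaw π h d m).real B + (T * e
        + ∑ j, (g0 j + (g1 j - g0 j) * (rowLaw h d).real E)) := by
      simp only [hF]
      rw [integral_add hBi hresti,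
        integral_add (integrable_const _) hsumi, integral_finsetSum _ fun j _ => hind j,
        integral_indicator_one hBm]
      simp [hI]
    rw [hInt, hpot]
    have hsum : ∑ j, (g0 j + (g1 j - g0 j) * (rowLaw h d).real E)
        ≤ ∑ j, nodePotential π.ℓ p (T + 1) i (s j) := by
      refine Finset.sum_le_sum fun j _ => le_trans ?_ (hg j)
      have := mul_le_mul_of_nonneg_left hEp (sub_nonneg.2 (hg1 j))
      linarith
    push_cast
    linarith

open Classical in
/-- A bound for the probability that the honest nodes do not reach final consensus in time, when
`T` rounds of the cooling-off period are left; `K` accounts for the later rounds. -/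
noncomputable def coolingPotential (θ e f K : ℝ) (T : ℕ) (s : Fin h → NodeState) : ℝ :=
  T * e + K + if ∃ i, NearConsensus θ i (opinions s) then 0 else f ^ T

/-- From near consensus the expected loss is at most f^T·e ≤ e, which pays for one summand `e`.
Otherwise the round fails with probability at most f, and f^T·f = f^(T+1). -/
theorem coolingPotential_step (hh : 0 < h) (hq : q = (d : ℝ) / ((h : ℝ) + d)) (π : Params)
    (hk : 1 ≤ π.k) (hqβ : q < π.β) (hβ : π.β < 1 / 2) (hφ : 0 < phi π.β q π.k)
    (hcontrol : controlLength π.β q π.k < 1 - 2 * π.β) {f K : ℝ}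
    (hf : failProb π.β q (h + d) π.k = f) (hf1 : f ≤ 1) (hK : 0 ≤ K)
    {m : ℕ} (hm : m ≠ 0) (T : ℕ) (s : Fin h → NodeState) (hs : ∀ j, (s j).final = false)
    (y : Fin d → Bool) (ans : Queries h d → Fin d → Fin h → ℕ → Bool) :
    ∫⁻ r, ENNReal.ofReal (coolingPotential ((π.β - q) / (2 * (1 - q)))
        (Real.exp (-2 * h * phi π.β q π.k ^ 2)) f K T
        (fun j => (s j).update π (m + 1) (decision π.k (opinions s) y (ans r.1) r j)))
        ∂(roundLaw π h d m)
      ≤ ENNReal.ofReal (coolingPotential ((π.β - q) / (2 * (1 - q)))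
        (Real.exp (-2 * h * phi π.β q π.k ^ 2)) f K (T + 1) s) := by
  classical
  have := isProbabilityMeasure_roundLaw (d := d) hh π m
  have hf0 : 0 ≤ f := hf ▸ failProb_nonneg _ (q_nonneg hh hq) hβ
  set θ := (π.β - q) / (2 * (1 - q)) with hθ
  set e := Real.exp (-2 * h * phi π.β q π.k ^ 2) with he
  have he0 : 0 ≤ e := (Real.exp_pos _).le
  have hTe : 0 ≤ T * e + K := by positivity
  set B : Set (RoundData h d) :=
    {r | ∀ i, ¬ NearConsensus θ i (decision π.k (opinions s) y (ans r.1) r)} with hB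
  have hop : ∀ r : RoundData h d, opinions (fun j =>
      (s j).update π (m + 1) (decision π.k (opinions s) y (ans r.1) r j))
      = decision π.k (opinions s) y (ans r.1) r := by
    intro r
    funext j
    simp [opinions, NodeState.update, hs j]
  have hbound : ∀ b : ℝ, (roundLaw π h d m).real B ≤ b → 0 ≤ b →
      ∫⁻ r, ENNReal.ofReal (coolingPotential θ e f K T
        (fun j => (s j).update π (m + 1) (decision π.k (opinions s) y (ans r.1) r j)))
        ∂(roundLaw π h d m) ≤ ENNReal.ofReal (T * e + K + f ^ T * b) := by
    intro b hb hb0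
    calc _ ≤ ∫⁻ r, (ENNReal.ofReal (T * e + K) + B.indicator (fun _ => ENNReal.ofReal (f ^ T)) r)
          ∂(roundLaw π h d m) := by
          refine lintegral_mono fun r => ?_
          unfold coolingPotential
          rw [hop]
          by_cases hr : r ∈ B
          · rw [Set.indicator_of_mem hr, if_neg (not_exists.2 hr),
              ENNReal.ofReal_add hTe (pow_nonneg hf0 T)]
          · have : ∃ i, NearConsensus θ i (decision π.k (opinions s) y (ans r.1) r) := by
              by_contra hn
              exact hr (not_exists.1 hn)
            rw [if_pos this, add_zero]
            exact le_self_add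
      _ ≤ ENNReal.ofReal (T * e + K) + ENNReal.ofReal (f ^ T) * ENNReal.ofReal b := by
          rw [lintegral_add_left measurable_const, lintegral_const, measure_univ, mul_one]
          refine add_le_add le_rfl ((lintegral_indicator_const_le _ _).trans ?_)
          gcongr
          rw [← ofReal_measureReal]
          exact ENNReal.ofReal_le_ofReal hb
      _ = _ := by
          rw [← ENNReal.ofReal_mul (pow_nonneg hf0 T),
            ← ENNReal.ofReal_add hTe (mul_nonneg (pow_nonneg hf0 T) hb0)]
  by_cases hnc : ∃ i, NearConsensus θ i (opinions s)
  · obtain ⟨i, hi⟩ := hnc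
    have hlost := decision_lost_prob_le hh hq π hk hqβ hβ hφ hm i (opinions s) y ans hi
    refine (hbound e ((measureReal_mono (fun r (hr : r ∈ B) => hr i)).trans hlost) he0).trans
      (ENNReal.ofReal_le_ofReal ?_)
    rw [coolingPotential, if_pos ⟨i, hi⟩]
    have := mul_le_of_le_one_left he0 (pow_le_one₀ hf0 hf1 : f ^ T ≤ 1)
    push_cast
    linarith
  · refine (hbound f (hf ▸ decision_fail_prob_le hh hq π hk hqβ hβ hcontrol hm (opinions s) y ans)
      hf0).trans (ENNReal.ofReal_le_ofReal ?_)
    rw [coolingPotential, if_neg hnc, pow_succ]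
    push_cast
    linarith

end FPC

/-! ### Assembling the potentials into the final estimate -/

namespace FPC

open ProbabilityTheory

variable {S : Type*} [MeasurableSpace S] {h d : ℕ} {q : ℝ}

/-- A supermartingale has decreasing expectations; the drift condition is required for every past,
with round `m + 1` integrated out. -/
theorem lintegral_le_of_step (hh : 0 < h) (π : Params) (ν : Measure S) [IsProbabilityMeasure ν]
    (V : ℕ → Sample S h d → ENNReal) (hV : ∀ m, Measurable (V m)) (a : ℕ) (t : ℕ)
    (hstep : ∀ m, a ≤ m → m < a + t → ∀ ω,
      ∫⁻ r, V (m + 1) (resample ω m r) ∂(roundLaw π h d m) ≤ V m ω) :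
    ∫⁻ ω, V (a + t) ω ∂(law π h d ν) ≤ ∫⁻ ω, V a ω ∂(law π h d ν) := by
  induction t with
  | zero => exact le_rfl
  | succ t ih =>
    refine le_trans ?_ (ih fun m h1 h2 => hstep m h1 (by omega))
    rw [← add_assoc, lintegral_law_resample hh π ν (a + t) (hV _)]
    exact lintegral_mono fun ω => hstep (a + t) (by omega) (by omega) ω

variable (π : Params) (init : S → Fin h → Bool) (A : SemiCautiousAdversary S h d)

theorem state_consistent (hℓ : 1 ≤ π.ℓ) (ω : Sample S h d) (m : ℕ) (j : Fin h) :
    (state π init A ω m j).Consistent π.ℓ := by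
  induction m with
  | zero => simp [NodeState.Consistent, state]; omega
  | succ m ih => rw [state_succ]; exact ih.update _ _

theorem state_cooling (hℓ : 1 ≤ π.ℓ) (ω : Sample S h d) {m : ℕ} (hm : m ≤ π.m₀) (j : Fin h) :
    (state π init A ω m j).final = false ∧ (state π init A ω m j).run = 0 := by
  induction m with
  | zero => exact ⟨rfl, rfl⟩
  | succ m ih =>
    have hi := ih (by omega)
    rw [state_succ]
    simp [NodeState.update, hi.1, hm]
    omega

theorem subset_consensusWithin (M : ℕ) :
    {ω | ∃ i, ∀ j, (state π init A ω M j).final = true ∧ (state π init A ω M j).opinion = i}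
      ⊆ consensusWithin π init A M := by
  rintro ω ⟨i, hi⟩
  refine ⟨?_, ?_⟩
  · cases i
    · exact Or.inl fun j => ⟨M, hi j⟩
    · exact Or.inr fun j => ⟨M, hi j⟩
  · exact iSup_le fun j => iInf₂_le (f := fun (m : ℕ) (_ : (state π init A ω m j).final = true) =>
      (m : ℕ∞)) M (hi j).1

/-- At the end of the time horizon the potential dominates the indicator of failure, so its
expectation bounds the failure probability. -/
theorem one_le_consensusPotential_zero {ℓ : ℕ} {p : ℝ} (hℓ : 1 ≤ ℓ) (hp0 : 0 < p) (hp1 : p < 1)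
    (θ e : ℝ) (i : Bool) (s : Fin h → NodeState) (hs : ∀ j, (s j).Consistent ℓ)
    (hfail : ¬ ∀ j, (s j).final = true ∧ (s j).opinion = i) :
    1 ≤ consensusPotential ℓ θ p e 0 i s := by
  unfold consensusPotential
  split_ifs
  · push Not at hfail
    obtain ⟨j, hj⟩ := hfail
    have h1 := one_le_nodePotential_zero (ℓ := ℓ) hℓ hp0 hp1 i (s j) fun ho => by
      by_contra hl
      exact hj ((hs j).2 (not_lt.1 hl)) ho
    have h2 := Finset.single_le_sum (f := fun j => nodePotential ℓ p 0 i (s j))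
      (fun j _ => nodePotential_nonneg hp0 hp1 0 i (s j)) (Finset.mem_univ j)
    simp only [Nat.cast_zero, zero_mul, zero_add]
    exact le_min le_rfl (h1.trans h2)
  · exact le_rfl

open Classical in
/-- The opinion the honest nodes are close to agreeing on (`0` if there is none). -/
noncomputable def leadingOpinion (θ : ℝ) (s : Fin h → NodeState) : Bool :=
  decide (NearConsensus θ true (opinions s))

theorem nearConsensus_leadingOpinion {θ : ℝ} {s : Fin h → NodeState}
    (hs : ∃ i, NearConsensus θ i (opinions s)) :
    NearConsensus θ (leadingOpinion θ s) (opinions s) := by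
  unfold leadingOpinion
  by_cases ht : NearConsensus θ true (opinions s)
  · simp [ht]
  · obtain ⟨i, hi⟩ := hs
    cases i
    · simpa [ht] using hi
    · exact absurd hi ht

/-- The handover at the end of the cooling-off period: near consensus, all runs are 0 and each node
costs the bracket in `W`; otherwise f⁰ = 1 already covers everything. -/
theorem consensusPotential_le_coolingPotential {ℓ : ℕ} {p : ℝ} (hp0 : 0 < p) (hp1 : p < 1)
    {θ e f K : ℝ} (hK : 0 ≤ K) (u : ℕ) (s : Fin h → NodeState) (hs : ∀ j, (s j).run = 0)
    (hKu : (ℓ * u : ℕ) * e + h * ((1 - (1 - p) ^ ℓ) ^ u + (p / (1 - p)) ^ (ℓ - 1)) ≤ K) :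
    consensusPotential ℓ θ p e (ℓ * u) (leadingOpinion θ s) s ≤ coolingPotential θ e f K 0 s := by
  unfold coolingPotential
  split_ifs with hnc
  · rw [consensusPotential, if_pos (nearConsensus_leadingOpinion hnc)]
    refine (min_le_right _ _).trans ?_
    have : ∑ j, nodePotential ℓ p (ℓ * u) (leadingOpinion θ s) (s j)
        ≤ ∑ _j : Fin h, ((1 - (1 - p) ^ ℓ) ^ u + (p / (1 - p)) ^ (ℓ - 1)) :=
      Finset.sum_le_sum fun j _ => nodePotential_start_le hp0 hp1 u _ _ (hs j)
    rw [Finset.sum_const, Finset.card_univ, Fintype.card_fin, nsmul_eq_mul] at this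
    simp only [Nat.cast_zero, zero_mul, zero_add, add_zero]
    linarith
  · refine (consensusPotential_le_one _ _ _ _ _ _ _).trans ?_
    simp only [Nat.cast_zero, zero_mul, zero_add, pow_zero]
    linarith

theorem measurable_comp_state (hinit : Measurable init) (m m' : ℕ)
    (F : (Fin h → NodeState) → (Fin h → NodeState) → ENNReal) :
    Measurable fun ω => F (state π init A ω m) (state π init A ω m') := by
  have hF : Measurable (Function.uncurry F) := Measurable.of_discrete
  exact hF.comp ((measurable_state π init A hinit m).prodMk (measurable_state π init A hinit m'))

/-- Final consensus is reached in time, up to the probability that closeness to consensus is not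
reached in one of the cooling-off rounds with a random threshold and the terms of `W`. -/
theorem one_sub_le_consensusWithin (hh : 0 < h) (hq : q = (d : ℝ) / ((h : ℝ) + d))
    (hk : 1 ≤ π.k) (hm₀ : 1 ≤ π.m₀) (hℓ : 1 ≤ π.ℓ) (hqβ : q < π.β) (hβ : π.β < 1 / 2)
    (hφ : 0 < phi π.β q π.k) (hcontrol : controlLength π.β q π.k < 1 - 2 * π.β)
    (hf1 : failProb π.β q (h + d) π.k ≤ 1) (ν : Measure S) [IsProbabilityMeasure ν]
    (hinit : Measurable init) (u : ℕ) :
    1 - failProb π.β q (h + d) π.k ^ (π.m₀ - 1) - W π.β q (h + d) π.k π.m₀ π.ℓ u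
      ≤ (law π h d ν).real (consensusWithin π init A (π.m₀ + π.ℓ * u)) := by
  have := isProbabilityMeasure_law (d := d) hh π ν
  set θ := (π.β - q) / (2 * (1 - q)) with hθ
  set p := errProb π.β q π.k with hp
  set e := Real.exp (-2 * h * phi π.β q π.k ^ 2) with he
  set f := failProb π.β q (h + d) π.k with hf
  have hp0 : 0 < p := errProb_pos _ _ _
  have hp1 : p < 1 := errProb_lt_one hk hqβ
  have he0 : 0 ≤ e := (Real.exp_pos _).le
  have hf0 : 0 ≤ f := failProb_nonneg _ (q_nonneg hh hq) hβ
  set K := ((π.ℓ * u : ℕ) : ℝ) * e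
    + h * ((1 - (1 - p) ^ π.ℓ) ^ u + (p / (1 - p)) ^ (π.ℓ - 1)) with hK
  have hD : 0 ≤ 1 - (1 - p) ^ π.ℓ := (one_sub_pow_mem hp0 hp1 _).1
  have hR : 0 ≤ p / (1 - p) := div_nonneg hp0.le (by linarith)
  have hK0 : 0 ≤ K := by positivity
  set M := π.m₀ + π.ℓ * u with hM
  set V₁ : ℕ → Sample S h d → ENNReal := fun m ω =>
    ENNReal.ofReal (coolingPotential θ e f K (π.m₀ - m) (state π init A ω m)) with hV₁
  -- The target opinion is random but frozen after round m₀, so resampling a later round leaves it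
  -- unchanged.
  set V₂ : ℕ → Sample S h d → ENNReal := fun m ω =>
    ENNReal.ofReal (consensusPotential π.ℓ θ p e (M - m)
      (leadingOpinion θ (state π init A ω π.m₀)) (state π init A ω m)) with hV₂
  have hmV₁ : ∀ m, Measurable (V₁ m) := fun m => measurable_comp_state π init A hinit m m
    fun _ s => ENNReal.ofReal (coolingPotential θ e f K (π.m₀ - m) s)
  have hmV₂ : ∀ m, Measurable (V₂ m) := fun m => measurable_comp_state π init A hinit π.m₀ m
    fun s s' => ENNReal.ofReal (consensusPotential π.ℓ θ p e (M - m) (leadingOpinion θ s) s')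
  have hres : ∀ (ω : Sample S h d) (m : ℕ) (r : RoundData h d),
      state π init A (resample ω m r) (m + 1) = fun j => (state π init A ω m j).update π (m + 1)
        (decision π.k (opinions (state π init A ω m)) (A.opinion m (history ω m))
          (A.answers m (history ω m, r.1)) r j) := fun ω m r =>
    funext fun j => state_succ_resample π init A ω m r j
  -- The chain starts after round 1, whose threshold has a different law. The opinions at that
  -- moment are treated as arbitrary, and m₀-1 rounds remain.
  have hchain₁ : ∫⁻ ω, V₁ π.m₀ ω ∂(law π h d ν) ≤ ∫⁻ ω, V₁ 1 ω ∂(law π h d ν) := by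
    have := lintegral_le_of_step hh π ν V₁ hmV₁ 1 (π.m₀ - 1) fun m h1 h2 ω => by
      simp only [hV₁, hres]
      have := coolingPotential_step hh hq π hk hqβ hβ hφ hcontrol hf.symm hf1 hK0
        (m := m) (by omega) (π.m₀ - (m + 1)) (state π init A ω m)
        (fun j => (state_cooling π init A hℓ ω (by omega) j).1) (A.opinion m (history ω m))
        (fun Q => A.answers m (history ω m, Q))
      rwa [show π.m₀ - (m + 1) + 1 = π.m₀ - m by omega] at this
    rwa [show 1 + (π.m₀ - 1) = π.m₀ by omega] at this
  have hchain₂ : ∫⁻ ω, V₂ M ω ∂(law π h d ν) ≤ ∫⁻ ω, V₂ π.m₀ ω ∂(law π h d ν) := by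
    refine lintegral_le_of_step hh π ν V₂ hmV₂ π.m₀ (π.ℓ * u) fun m h1 h2 ω => ?_
    simp only [hV₂, hres, state_resample π init A ω h1]
    have := consensusPotential_step hh hq π hk hℓ hqβ hβ hφ (m := m) (by omega) h1
      (M - (m + 1)) (leadingOpinion θ (state π init A ω π.m₀)) (state π init A ω m)
      (fun j => state_consistent π init A hℓ ω m j) (A.opinion m (history ω m))
      (fun Q => A.answers m (history ω m, Q))
    rwa [show M - (m + 1) + 1 = M - m by omega] at this
  have hlink : ∫⁻ ω, V₂ π.m₀ ω ∂(law π h d ν) ≤ ∫⁻ ω, V₁ π.m₀ ω ∂(law π h d ν) := by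
    refine lintegral_mono fun ω => ENNReal.ofReal_le_ofReal ?_
    rw [show M - π.m₀ = π.ℓ * u by omega, Nat.sub_self]
    exact consensusPotential_le_coolingPotential hp0 hp1 hK0 u _
      (fun j => (state_cooling π init A hℓ ω le_rfl j).2) le_rfl
  have hstart : ∫⁻ ω, V₁ 1 ω ∂(law π h d ν)
      ≤ ENNReal.ofReal (f ^ (π.m₀ - 1) + (((π.m₀ - 1 : ℕ) : ℝ) * e + K)) := by
    calc _ ≤ ∫⁻ _ω, ENNReal.ofReal (f ^ (π.m₀ - 1) + (((π.m₀ - 1 : ℕ) : ℝ) * e + K))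
          ∂(law π h d ν) := by
          refine lintegral_mono fun ω => ENNReal.ofReal_le_ofReal ?_
          unfold coolingPotential
          have : 0 ≤ f ^ (π.m₀ - 1) := pow_nonneg hf0 _
          split_ifs <;> linarith
      _ = _ := by simp
  set G : Set (Sample S h d) :=
    {ω | ∃ i, ∀ j, (state π init A ω M j).final = true ∧ (state π init A ω M j).opinion = i} with hG
  have hGm : MeasurableSet G :=
    (MeasurableSet.of_discrete (s := {s : Fin h → NodeState |
      ∃ i, ∀ j, (s j).final = true ∧ (s j).opinion = i})).preimage (measurable_state π init A hinit M)
  have hcompl : (law π h d ν) Gᶜ ≤ ∫⁻ ω, V₂ M ω ∂(law π h d ν) := by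
    rw [← lintegral_indicator_one hGm.compl]
    refine lintegral_mono fun ω => ?_
    by_cases hω : ω ∈ Gᶜ
    · rw [Set.indicator_of_mem hω]
      refine ENNReal.one_le_ofReal.2 ?_
      rw [Nat.sub_self]
      exact one_le_consensusPotential_zero hℓ hp0 hp1 θ e _ _
        (fun j => state_consistent π init A hℓ ω M j) (fun hall => hω ⟨_, hall⟩)
    · rw [Set.indicator_of_notMem hω]
      exact zero_le
  have hfail : (law π h d ν).real Gᶜ ≤ f ^ (π.m₀ - 1) + (((π.m₀ - 1 : ℕ) : ℝ) * e + K) :=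
    ENNReal.toReal_le_of_le_ofReal (by positivity)
      (hcompl.trans (hchain₂.trans (hlink.trans (hchain₁.trans hstart))))
  -- Only m₀-1 cooling-off rounds incur a loss `e`, so `W` has one such term to spare.
  have hWle : ((π.m₀ - 1 : ℕ) : ℝ) * e + K ≤ W π.β q (h + d) π.k π.m₀ π.ℓ u := by
    have hcast : (((π.m₀ - 1 : ℕ)) : ℝ) ≤ π.m₀ := by exact_mod_cast Nat.sub_le _ _
    have h1 := mul_le_mul_of_nonneg_right hcast he0
    unfold W
    rw [← hp, show -2 * (1 - q) * ((h + d : ℕ) : ℝ) * phi π.β q π.k ^ 2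
      = -2 * ((1 - q) * ((h : ℝ) + d)) * phi π.β q π.k ^ 2 by push_cast; ring,
      show (1 - q) * ((h + d : ℕ) : ℝ) = (1 - q) * ((h : ℝ) + d) by push_cast; ring,
      one_sub_mul_eq hh hq, ← he, hK]
    push_cast
    linarith
  have hmono := measureReal_mono (μ := law π h d ν) (subset_consensusWithin π init A M)
  rw [← hG] at hmono
  rw [measureReal_compl hGm, probReal_univ] at hfail
  linarith

theorem W_nonneg {β q : ℝ} {k : ℕ} (hk : 1 ≤ k) (hqβ : q < β) (hq1 : q ≤ 1) (n m₀ ℓ u : ℕ) :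
    0 ≤ W β q n k m₀ ℓ u := by
  have hp0 : 0 < errProb β q k := errProb_pos _ _ _
  have hp1 : errProb β q k < 1 := errProb_lt_one hk hqβ
  have h1 := (one_sub_pow_mem hp0 hp1 ℓ).1
  have h2 : 0 ≤ errProb β q k / (1 - errProb β q k) := div_nonneg hp0.le (by linarith)
  have h3 : 0 ≤ 1 - q := sub_nonneg.2 hq1
  unfold W
  positivity

end FPC

theorem theorem3
    -- `h ≥ 1` honest and `d` adversarial nodes, `n = h + d`, proportion `q = d / n`
    (h d n : ℕ) (hh : 0 < h) (hn : n = h + d) (q : ℝ) (hq : q = (d : ℝ) / (n : ℝ))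
    -- parameters of the protocol
    (π : FPC.Params) (hk : 1 ≤ π.k) (hm₀ : 1 ≤ π.m₀) (hℓ : 1 ≤ π.ℓ)
    (ha : 1 / 2 < π.a) (hab : π.a ≤ π.b) (hb : π.b < 1)
    (hqβ : q < π.β) (hβ : π.β < 1 / 2)
    (hφ : 0 < FPC.phi π.β q π.k)
    (hcontrol : FPC.controlLength π.β q π.k < 1 - 2 * π.β)
    -- the seed, arbitrary initial opinions, an arbitrary semi-cautious strategy
    {S : Type*} [MeasurableSpace S] (ν : MeasureTheory.Measure S)
    [MeasureTheory.IsProbabilityMeasure ν]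
    (init : S → Fin h → Bool) (hinit : Measurable init)
    (A : FPC.SemiCautiousAdversary S h d) (u : ℕ) :
    (3 ≤ π.m₀ →
      1 - FPC.psiSemi π.β q n π.k ^ π.m₀ - FPC.W π.β q n π.k π.m₀ π.ℓ u ≤
        (FPC.law π h d ν).real (FPC.consensusWithin π init A (π.m₀ + π.ℓ * u))) ∧
    1 - FPC.psiSemi π.β q n π.k ^ (π.m₀ - 1) - FPC.W π.β q n π.k π.m₀ π.ℓ u ≤
      (FPC.law π h d ν).real (FPC.consensusWithin π init A (π.m₀ + π.ℓ * u)) := by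
  subst hn
  have hq' : q = (d : ℝ) / ((h : ℝ) + d) := by rw [hq]; push_cast; rfl
  have hq0 := FPC.q_nonneg hh hq'
  have hq1 := FPC.q_lt_one hh hq'
  have hW := FPC.W_nonneg hk hqβ hq1.le (h + d) π.m₀ π.ℓ u
  have hle := FPC.failProb_le_psiSemi (k := π.k) (h + d) hqβ hβ hcontrol
  have hf0 := FPC.failProb_nonneg (k := π.k) (h + d) hq0 hβ
  have hreal : 0 ≤ (FPC.law π h d ν).real (FPC.consensusWithin π init A (π.m₀ + π.ℓ * u)) :=
    MeasureTheory.measureReal_nonneg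
  -- The estimate needs `failProb ≤ 1`, which follows from ψ ≤ 1. If ψ > 1, the claimed lower bounds
  -- are at most 0, because `W` is nonnegative.
  rcases le_or_gt (FPC.psiSemi π.β q (h + d) π.k) 1 with hψ | hψ
  · have key := FPC.one_sub_le_consensusWithin π init A hh hq' hk hm₀ hℓ hqβ hβ hφ hcontrol
      (hle.trans hψ) ν hinit u
    refine ⟨fun h3 => ?_, ?_⟩
    · have := FPC.failProb_pow_le (k := π.k) (h + d) π.m₀ h3 hq0 hqβ hβ hcontrol hψ
      linarith
    · have := pow_le_pow_left₀ hf0 hle (π.m₀ - 1)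
      linarith
  · have hone : ∀ m : ℕ, 1 ≤ FPC.psiSemi π.β q (h + d) π.k ^ m := fun m => one_le_pow₀ hψ.le
    exact ⟨fun _ => by linarith [hone π.m₀], by linarith [hone (π.m₀ - 1)]⟩
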